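/- Let $n,m\ge 0$ and let $F_k\in\mathbb R^{n\times n}$, $H_k\in\mathbb R^{m\times n}$ ($k=0,1,\dots$) be matrices. On a probability space let random vectors satisfy $$x_{k+1}=F_kx_k+u_k,\qquad z_k=H_kx_k+w_k,\qquad k=0,1,\dots,$$ where $x_0,u_k$ ($\mathbb R^n$-valued) have finite second moments and need not be Gaussian, and * $E[u_k]=0$, $E[u_ku_l^T]=U_k\delta_{kl}$; $u_k$ and $u_l$ are independent for $k\ne l$; $u_k$ and $x_l$ are independent for $l\le k$; * $\{w_k\}$ is a Gaussian process ($\mathbb R^m$-valued) with $E[w_k]=0$, $E[w_kw_l^T]=W_k\delta_{kl}$, $W_k$ positive definite; * the noise process $\{w_k\}$ is independent of the signal process $\{x_k\}$ (hence also of $\{u_k\}$). Let $\hat x_{j|j-1}$ and $\hat x_{j|j}$ be linear least-squares estimates of $x_j$ given $z_0,\dots,z_{j-1}$ and given $z_0,\dots,z_j$, respectively, i.e. minimizers of the mean-square error among all $a+\sum_l A_lz_l$ (sum over the given observations; $a$ a constant vector, $A_l$ constant matrices). Put $$M_j=E[(x_j-\hat x_{j|j-1})(x_j-\hat x_{j|j-1})^T],\quad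 P_j=E[(x_j-\hat x_{j|j})(x_j-\hat x_{j|j})^T],\quad R_j=E[\nu_j\nu_j^T],\ \ \nu_j=z_j-H_j\hat x_{j|j-1}.$$ Let $x^k=(x_0,\dots,x_k)$, $z^k=(z_0,\dots,z_k)$, let $I[\cdot\,;\cdot]$ be mutual information, $\log$ the natural logarithm and $|A|$ the determinant of $A$. Then for every $k\ge 0$, $I[x^k;z^k]$ is finite and $$I[x^k;z^k]\le\frac12\sum_{j=0}^k\log\frac{|W_j+H_jM_jH_j^T|}{|W_j|}=\frac12\sum_{j=0}^k\log\frac{|R_j|}{|W_j|},$$ and, if $M_0,\dots,M_k$ are positive definite, this common value equals $$\frac12\sum_{j=0}^k\log\frac{|M_j|}{|P_j|}.$$ The matrices $M_0,\dots,M_k$ and $P_0,\dots,P_k$ are positive definite whenever the covariance matrix of $x_0$ is positive definite and $F_0,\dots,F_{k-1}$ are nonsingular. -/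

import Mathlib

open MeasureTheory ProbabilityTheory
open scoped Matrix ENNReal

noncomputable section

/-- The matrix `E[X Yᵀ]` of two random vectors. -/
def expOuter {Ω : Type*} [MeasurableSpace Ω] (μ : Measure Ω) {a b : ℕ}
    (X : Ω → Fin a → ℝ) (Y : Ω → Fin b → ℝ) : Matrix (Fin a) (Fin b) ℝ :=
  Matrix.of fun i j => ∫ ω, X ω i * Y ω j ∂μ

/-- The covariance matrix `E[(X - E X) (X - E X)ᵀ]` of a random vector. -/
def covMat {Ω : Type*} [MeasurableSpace Ω] (μ : Measure Ω) {a : ℕ}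
    (X : Ω → Fin a → ℝ) : Matrix (Fin a) (Fin a) ℝ :=
  expOuter μ (fun ω i => X ω i - ∫ ω', X ω' i ∂μ) (fun ω i => X ω i - ∫ ω', X ω' i ∂μ)

/-- The mutual information `I[X; Y]` in nats: the Kullback-Leibler divergence of the joint law
from the product of the marginal laws. -/
def mutualInfo {Ω α β : Type*} [MeasurableSpace Ω] [MeasurableSpace α] [MeasurableSpace β]
    (μ : Measure Ω) (X : Ω → α) (Y : Ω → β) : ℝ≥0∞ :=
  InformationTheory.klDiv (μ.map fun ω => (X ω, Y ω)) ((μ.map X).prod (μ.map Y))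

/-- The block `(y₀, …, yₖ)` of a process, as a single random element. -/
def block {Ω : Type*} {a : ℕ} (y : ℕ → Ω → Fin a → ℝ) (k : ℕ) :
    Ω → Fin (k + 1) → Fin a → ℝ :=
  fun ω j => y j ω

/-- The linear estimator `a + ∑_{l < r} A_l z_l` based on the first `r` observations
`z₀, …, z_{r-1}`; the constant `a` accounts for signals that are not centered. -/
def linearEstimator {Ω : Type*} {n m : ℕ} (z : ℕ → Ω → Fin m → ℝ) (r : ℕ)
    (a : Fin n → ℝ) (A : ℕ → Matrix (Fin n) (Fin m) ℝ) : Ω → Fin n → ℝ :=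
  fun ω => a + ∑ l ∈ Finset.range r, A l *ᵥ z l ω

/-- The mean-square error `E[|s - t|²]` (Euclidean norm). -/
def meanSquareError {Ω : Type*} [MeasurableSpace Ω] (μ : Measure Ω) {n : ℕ}
    (s t : Ω → Fin n → ℝ) : ℝ :=
  ∫ ω, ∑ i, (s ω i - t ω i) ^ 2 ∂μ

/-- `t` is the linear least-squares estimate of `s` given the first `r` observations
`z₀, …, z_{r-1}`: a linear estimator whose mean-square error is smallest possible. -/
def IsLinearLeastSquares {Ω : Type*} [MeasurableSpace Ω] (μ : Measure Ω) {n m : ℕ}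
    (z : ℕ → Ω → Fin m → ℝ) (r : ℕ) (s t : Ω → Fin n → ℝ) : Prop :=
  (∃ a A, t = linearEstimator z r a A) ∧
    ∀ a A, meanSquareError μ s t ≤ meanSquareError μ s (linearEstimator z r a A)

/-- The linear state-space model with Gaussian observation noise and a signal that need not be
Gaussian. Since `u k = x (k + 1) - F k x k`, the independence of the whole signal `x` and the
whole noise `w` contains that of `u k` and `w l` for all `k`, `l`, and so `E[u_k w_lᵀ] = 0`. -/
structure IsKalmanModel {Ω : Type*} [MeasurableSpace Ω] (μ : Measure Ω) {n m : ℕ}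
    (x u : ℕ → Ω → Fin n → ℝ) (w z : ℕ → Ω → Fin m → ℝ)
    (F : ℕ → Matrix (Fin n) (Fin n) ℝ) (H : ℕ → Matrix (Fin m) (Fin n) ℝ)
    (U : ℕ → Matrix (Fin n) (Fin n) ℝ) (W : ℕ → Matrix (Fin m) (Fin m) ℝ) : Prop where
  state_eq : ∀ k ω, x (k + 1) ω = F k *ᵥ x k ω + u k ω
  obs_eq : ∀ k ω, z k ω = H k *ᵥ x k ω + w k ω
  memLp_init : MemLp (x 0) 2 μ
  memLp_input : ∀ k, MemLp (u k) 2 μ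
  mean_input : ∀ k i, ∫ ω, u k ω i ∂μ = 0
  cov_input : ∀ k l, expOuter μ (u k) (u l) = if k = l then U k else 0
  gaussian_noise : IsGaussianProcess w μ
  mean_noise : ∀ k i, ∫ ω, w k ω i ∂μ = 0
  cov_noise : ∀ k l, expOuter μ (w k) (w l) = if k = l then W k else 0
  posDef_noise : ∀ k, (W k).PosDef
  indep_input : ∀ k l, k ≠ l → IndepFun (u k) (u l) μ
  indep_input_signal : ∀ k l, l ≤ k → IndepFun (u k) (x l) μ
  indep_signal_noise : IndepFun (fun ω k => x k ω) (fun ω k => w k ω) μ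

/-- The covariance matrix `E[(s - t) (s - t)ᵀ]` of the error of an estimate `t` of `s`. -/
def errorCov {Ω : Type*} [MeasurableSpace Ω] (μ : Measure Ω) {n : ℕ}
    (s t : Ω → Fin n → ℝ) : Matrix (Fin n) (Fin n) ℝ :=
  expOuter μ (fun ω => s ω - t ω) (fun ω => s ω - t ω)

/-- The covariance matrix `E[ν νᵀ]` of the innovation `ν = z - H t`, with `t` the prediction. -/
def innovationCov {Ω : Type*} [MeasurableSpace Ω] (μ : Measure Ω) {n m : ℕ}
    (z : Ω → Fin m → ℝ) (H : Matrix (Fin m) (Fin n) ℝ) (t : Ω → Fin n → ℝ) :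
    Matrix (Fin m) (Fin m) ℝ :=
  expOuter μ (fun ω => z ω - H *ᵥ t ω) (fun ω => z ω - H *ᵥ t ω)

end

/-! Stacked over time, the observations form one channel `Z = φ(X) + N`, with `X` the signal block
and `N` a Gaussian vector independent of it. For every law `Q`, the divergence of the joint law from
`law X × Q` exceeds `I[X;Z]` by the divergence of `law Z` from `Q`, hence bounds it
(`mutualInfo_le_klDiv_prod`). Take for `Q` the Gaussian law with the mean and covariance of `Z`. The
log-density is then a difference of quadratic forms, so its mean depends on second moments only, and
it equals `½ log (|cov Z| / |cov N|)` whether or not `X` is Gaussian. A congruence that whitens `N`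
and decorrelates `Z` reduces this to one-dimensional Gaussians (`mutualInfo_add_gaussian_le`).

The rest is second-order theory. Up to a constant, the innovations are a unit lower triangular
transform of the observations, and they are uncorrelated, so `|cov Z|` is the product of the
`|R_j|`, while `|cov N|` is the product of the `|W_j|`. Everything about the estimates follows from
orthogonality of their errors to all linear estimators: it gives `R = H M Hᵀ + W` and `P = M - M Hᵀ
R⁻¹ H M`, whence `|P| = |M| |W| / |R|` by Sylvester's determinant identity. Positive definiteness
passes from `M_j` to `P_j` by this formula, and from `P_j` to `M_{j+1} = F P Fᵀ + U` when `F` is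
invertible. -/

/-! ### Divergence bounds for mutual information -/

open InformationTheory in
/-- Replacing the law of the second variable by another one in the product of the marginals
does not decrease the divergence of the joint law. -/
theorem mutualInfo_le_klDiv_prod {Ω α β : Type*} [MeasurableSpace Ω] [MeasurableSpace α]
    [StandardBorelSpace α] [Nonempty α] [MeasurableSpace β] {μ : Measure Ω}
    [IsProbabilityMeasure μ] {X : Ω → α} {Z : Ω → β} (hX : AEMeasurable X μ)
    (hZ : AEMeasurable Z μ) (Q : Measure β) [IsProbabilityMeasure Q] :
    mutualInfo μ X Z ≤ klDiv (μ.map fun ω => (X ω, Z ω)) ((μ.map X).prod Q) := by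
  have := Measure.isProbabilityMeasure_map hX
  have := Measure.isProbabilityMeasure_map hZ
  have := Measure.isProbabilityMeasure_map (hX.prodMk hZ)
  have := Measure.isProbabilityMeasure_map (hZ.prodMk hX)
  have hswap : (μ.map fun ω => (Z ω, X ω)).map Prod.swap = μ.map fun ω => (X ω, Z ω) := by
    rw [AEMeasurable.map_map_of_aemeasurable measurable_swap.aemeasurable (hZ.prodMk hX)]
    rfl
  have hswap' : (μ.map fun ω => (X ω, Z ω)).map Prod.swap = μ.map fun ω => (Z ω, X ω) := by
    rw [AEMeasurable.map_map_of_aemeasurable measurable_swap.aemeasurable (hX.prodMk hZ)]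
    rfl
  have hZX := compProd_map_condDistrib (mβ := inferInstance) (X := Z) (μ := μ) hX
  -- Chain rule with `Z` first: `D(ZX ‖ Q × X) = D(Z ‖ Q) + D(ZX ‖ Z × X)`. It disintegrates over
  -- `Z`, hence the swaps, and the standard Borel assumption provides the conditional law of `X`.
  have hchain := klDiv_compProd_eq_add (μ.map Z) Q (condDistrib X Z μ)
    (Kernel.const β (μ.map X))
  rw [Measure.compProd_const, Measure.compProd_const, hZX] at hchain
  calc mutualInfo μ X Z
      = klDiv ((μ.map fun ω => (Z ω, X ω)).map Prod.swap)
          (((μ.map Z).prod (μ.map X)).map Prod.swap) := by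
        rw [hswap, Measure.prod_swap, mutualInfo]
    _ ≤ klDiv (μ.map fun ω => (Z ω, X ω)) ((μ.map Z).prod (μ.map X)) :=
        klDiv_map_le _ _ measurable_swap
    _ ≤ klDiv (μ.map fun ω => (Z ω, X ω)) (Q.prod (μ.map X)) := by
        rw [hchain]; exact le_add_self
    _ = klDiv ((μ.map fun ω => (X ω, Z ω)).map Prod.swap)
          (((μ.map X).prod Q).map Prod.swap) := by
        rw [hswap', Measure.prod_swap]
    _ ≤ _ := klDiv_map_le _ _ measurable_swap

open InformationTheory in
/-- Data processing: a measurable function of the second variable carries less information. -/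
theorem mutualInfo_comp_right_le {Ω α β γ : Type*} [MeasurableSpace Ω] [MeasurableSpace α]
    [MeasurableSpace β] [MeasurableSpace γ] {μ : Measure Ω}
    [IsProbabilityMeasure μ] {X : Ω → α} {Z : Ω → β} (hX : AEMeasurable X μ)
    (hZ : AEMeasurable Z μ) {g : β → γ} (hg : Measurable g) :
    mutualInfo μ X (fun ω => g (Z ω)) ≤ mutualInfo μ X Z := by
  have := Measure.isProbabilityMeasure_map hX
  have := Measure.isProbabilityMeasure_map hZ
  have := Measure.isProbabilityMeasure_map (hX.prodMk hZ)
  have h := klDiv_map_le (μ.map fun ω => (X ω, Z ω)) ((μ.map X).prod (μ.map Z))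
    (measurable_id.prodMap hg)
  rw [AEMeasurable.map_map_of_aemeasurable (measurable_id.prodMap hg).aemeasurable (hX.prodMk hZ),
    ← Measure.map_prod_map _ _ measurable_id hg, Measure.map_id,
    AEMeasurable.map_map_of_aemeasurable hg.aemeasurable hZ] at h
  exact h

/-! ### The additive Gaussian channel -/

/-- A product of probability measures with densities has the product density. -/
theorem pi_withDensity_eq {ι : Type*} [Fintype ι] {E : ι → Type*} [∀ i, MeasurableSpace (E i)]
    (ν : ∀ i, Measure (E i)) [∀ i, IsProbabilityMeasure (ν i)] {f : ∀ i, E i → ℝ≥0∞}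
    (hf : ∀ i, Measurable (f i)) [∀ i, SigmaFinite ((ν i).withDensity (f i))] :
    Measure.pi (fun i => (ν i).withDensity (f i)) =
      (Measure.pi ν).withDensity fun v => ∏ i, f i (v i) := by
  classical
  refine Measure.pi_eq fun s hs => ?_
  have hg : ∀ i, Measurable ((s i).indicator (f i)) := fun i => (hf i).indicator (hs i)
  -- On a box, the indicator times the product density is a product of functions of separate
  -- coordinates, which are independent under the product measure.
  have hind : iIndepFun (fun i (v : ∀ i, E i) => (s i).indicator (f i) (v i)) (Measure.pi ν) :=
    iIndepFun_pi fun i => (hg i).aemeasurable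
  have h := lintegral_prod_eq_prod_lintegral_of_indepFun Finset.univ _ hind
    fun i => (hg i).comp (measurable_pi_apply i)
  rw [withDensity_apply _ (MeasurableSet.univ_pi hs),
    ← lintegral_indicator (MeasurableSet.univ_pi hs)]
  convert! h using 1
  · refine lintegral_congr fun v => ?_
    simp only [Set.indicator, Set.mem_univ_pi]
    split_ifs with hv
    · exact Finset.prod_congr rfl fun i _ => by rw [if_pos (hv i)]
    · push Not at hv
      obtain ⟨i, hi⟩ := hv
      exact (Finset.prod_eq_zero (Finset.mem_univ i) (if_neg hi)).symm
  · refine Finset.prod_congr rfl fun i _ => ?_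
    rw [withDensity_apply _ (hs i), ← lintegral_indicator (hs i)]
    exact ((measurePreserving_eval ν i).lintegral_comp (hg i)).symm

/-- The density of `N(a, 1)` with respect to `N(b, D)`. -/
noncomputable def gaussianRatio (a b : ℝ) (D : NNReal) (t : ℝ) : ℝ :=
  gaussianPDFReal a 1 t / gaussianPDFReal b D t

theorem gaussianRatio_pos (a b : ℝ) {D : NNReal} (hD : D ≠ 0) (t : ℝ) :
    0 < gaussianRatio a b D t :=
  div_pos (gaussianPDFReal_pos _ _ _ one_ne_zero) (gaussianPDFReal_pos _ _ _ hD)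

theorem measurable_gaussianRatio (b : ℝ) (D : NNReal) :
    Measurable fun p : ℝ × ℝ => gaussianRatio p.1 b D p.2 := by
  have h1 : Measurable fun p : ℝ × ℝ => gaussianPDFReal p.1 1 p.2 :=
    measurable_uncurry_gaussianPDFReal.comp
      (measurable_fst.prodMk (measurable_const.prodMk measurable_snd))
  exact h1.div ((measurable_gaussianPDFReal b D).comp measurable_snd)

theorem gaussianReal_withDensity_gaussianRatio (a b : ℝ) {D : NNReal} (hD : D ≠ 0) :
    (gaussianReal b D).withDensity (fun t => ENNReal.ofReal (gaussianRatio a b D t)) =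
      gaussianReal a 1 := by
  have hm : Measurable fun t => ENNReal.ofReal (gaussianRatio a b D t) :=
    ((measurable_gaussianPDFReal a 1).div (measurable_gaussianPDFReal b D)).ennreal_ofReal
  rw [gaussianReal_of_var_ne_zero _ hD, gaussianReal_of_var_ne_zero _ one_ne_zero,
    ← withDensity_mul _ (measurable_gaussianPDF b D) hm]
  congr 1
  ext t
  have h := gaussianPDFReal_pos b D t hD
  simp only [Pi.mul_apply, gaussianPDF, gaussianRatio]
  rw [← ENNReal.ofReal_mul h.le, mul_div_cancel₀ _ h.ne']

theorem log_gaussianRatio (a b : ℝ) {D : NNReal} (hD : D ≠ 0) (t : ℝ) :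
    Real.log (gaussianRatio a b D t) =
      -(t - a) ^ 2 / 2 + (t - b) ^ 2 / (2 * D) + 1 / 2 * Real.log D := by
  have hD' : (0 : ℝ) < D := lt_of_le_of_ne D.2 (by exact_mod_cast hD.symm)
  have hpi := Real.pi_pos
  rw [gaussianRatio, Real.log_div (gaussianPDFReal_pos _ _ _ one_ne_zero).ne'
    (gaussianPDFReal_pos _ _ _ hD).ne', gaussianPDFReal, gaussianPDFReal,
    Real.log_mul (by positivity) (Real.exp_ne_zero _),
    Real.log_mul (by positivity) (Real.exp_ne_zero _), Real.log_exp, Real.log_exp,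
    Real.log_inv, Real.log_inv, Real.log_sqrt (by positivity), Real.log_sqrt (by positivity),
    Real.log_mul (by positivity) hD'.ne']
  simp
  ring

/-- A translate of the standard Gaussian law, as a density with respect to a Gaussian law with
independent coordinates. -/
theorem pi_gaussianReal_map_add {ι : Type*} [Fintype ι] (a b : ι → ℝ) {D : ι → NNReal}
    (hD : ∀ i, D i ≠ 0) :
    (Measure.pi fun _ : ι => gaussianReal 0 1).map (fun v => a + v) =
      (Measure.pi fun i => gaussianReal (b i) (D i)).withDensity
        fun v => ENNReal.ofReal (∏ i, gaussianRatio (a i) (b i) (D i) (v i)) := by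
  have h1 : (fun i => (gaussianReal (b i) (D i)).withDensity
      fun t => ENNReal.ofReal (gaussianRatio (a i) (b i) (D i) t)) =
      fun i => gaussianReal (a i) 1 :=
    funext fun i => gaussianReal_withDensity_gaussianRatio _ _ (hD i)
  have : ∀ i, SigmaFinite ((gaussianReal (b i) (D i)).withDensity
      fun t => ENNReal.ofReal (gaussianRatio (a i) (b i) (D i) t)) := fun i => by
    rw [gaussianReal_withDensity_gaussianRatio _ _ (hD i)]; infer_instance
  have h2 := pi_withDensity_eq (fun i => gaussianReal (b i) (D i))
    (f := fun i t => ENNReal.ofReal (gaussianRatio (a i) (b i) (D i) t))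
    fun i => ((measurable_gaussianRatio (b i) (D i)).comp
      (measurable_const.prodMk measurable_id)).ennreal_ofReal
  rw [h1] at h2
  have h3 : ((Measure.pi fun _ : ι => gaussianReal 0 1).map fun v i => a i + v i) =
      Measure.pi fun i => (gaussianReal 0 1).map fun t => a i + t := by
    have : ∀ i, SigmaFinite ((gaussianReal 0 1).map fun t => a i + t) := fun i => by
      rw [gaussianReal_map_const_add]; infer_instance
    exact Measure.pi_map_pi fun i => (measurable_const_add (a i)).aemeasurable
  simp_rw [gaussianReal_map_const_add, zero_add] at h3
  rw [show (fun v => a + v) = fun (v : ι → ℝ) i => a i + v i from rfl, h3, h2]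
  congr 1
  ext v
  rw [ENNReal.ofReal_prod_of_nonneg fun i _ => (gaussianRatio_pos _ _ (hD i) _).le]

/-- The likelihood ratio, at `(x, v)`, of the Gaussian law with mean `φ x` and identity covariance
to the Gaussian law with independent coordinates of means `b` and variances `D`. -/
noncomputable def channelDensity {α ι : Type*} [Fintype ι] (φ : α → ι → ℝ) (b : ι → ℝ)
    (D : ι → NNReal) (p : α × (ι → ℝ)) : ℝ :=
  ∏ i, gaussianRatio (φ p.1 i) (b i) (D i) (p.2 i)

theorem channelDensity_pos {α ι : Type*} [Fintype ι] (φ : α → ι → ℝ) (b : ι → ℝ)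
    {D : ι → NNReal} (hD : ∀ i, D i ≠ 0) (p : α × (ι → ℝ)) : 0 < channelDensity φ b D p :=
  Finset.prod_pos fun i _ => gaussianRatio_pos _ _ (hD i) _

theorem measurable_channelDensity {α ι : Type*} [MeasurableSpace α] [Fintype ι] {φ : α → ι → ℝ}
    (hφ : Measurable φ) (b : ι → ℝ) (D : ι → NNReal) : Measurable (channelDensity φ b D) := by
  unfold channelDensity
  refine Finset.measurable_fun_prod _ fun i _ => ?_
  have h1 : Measurable fun p : α × (ι → ℝ) => φ p.1 i :=
    (measurable_pi_apply i).comp (hφ.comp measurable_fst)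
  have h2 : Measurable fun p : α × (ι → ℝ) => p.2 i :=
    (measurable_pi_apply i).comp measurable_snd
  simpa only [Function.comp_def] using
    (measurable_gaussianRatio (b i) (D i)).comp (h1.prodMk h2)

/-- Given `X = x`, independence makes the output a translate by `φ x` of the standard Gaussian law;
its density from `pi_gaussianReal_map_add` is integrated over `x` by Fubini. -/
theorem map_channel_eq_withDensity {Ω α ι : Type*} [MeasurableSpace Ω] [MeasurableSpace α]
    [Fintype ι] {μ : Measure Ω} [IsProbabilityMeasure μ] {X : Ω → α} {V : Ω → ι → ℝ}
    {φ : α → ι → ℝ} (hX : AEMeasurable X μ) (hV : AEMeasurable V μ) (hφ : Measurable φ)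
    (hlaw : μ.map V = Measure.pi fun _ => gaussianReal 0 1) (hind : IndepFun X V μ)
    (b : ι → ℝ) {D : ι → NNReal} (hD : ∀ i, D i ≠ 0) :
    μ.map (fun ω => (X ω, φ (X ω) + V ω)) =
      ((μ.map X).prod (Measure.pi fun i => gaussianReal (b i) (D i))).withDensity
        fun p => ENNReal.ofReal (channelDensity φ b D p) := by
  have := Measure.isProbabilityMeasure_map hX
  have hshear : Measurable fun p : α × (ι → ℝ) => (p.1, φ p.1 + p.2) :=
    measurable_fst.prodMk ((hφ.comp measurable_fst).add measurable_snd)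
  have hjoint := (indepFun_iff_map_prod_eq_prod_map_map hX hV).1 hind
  have hmap : μ.map (fun ω => (X ω, φ (X ω) + V ω)) =
      ((μ.map X).prod (μ.map V)).map fun p : α × (ι → ℝ) => (p.1, φ p.1 + p.2) := by
    rw [← hjoint, AEMeasurable.map_map_of_aemeasurable hshear.aemeasurable (hX.prodMk hV)]
    rfl
  rw [hmap, hlaw]
  refine Measure.ext fun S hS => ?_
  rw [Measure.map_apply hshear hS, Measure.prod_apply (hshear hS), withDensity_apply _ hS,
    ← lintegral_indicator hS,
    lintegral_prod _
      (((measurable_channelDensity hφ b D).ennreal_ofReal.indicator hS).aemeasurable)]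
  refine lintegral_congr fun x => ?_
  have hSx : MeasurableSet (Prod.mk x ⁻¹' S) := measurable_prodMk_left hS
  have h := congrArg (fun m => m (Prod.mk x ⁻¹' S)) (pi_gaussianReal_map_add (φ x) b hD)
  rw [Measure.map_apply (measurable_const_add _) hSx, withDensity_apply _ hSx,
    ← lintegral_indicator hSx] at h
  exact h

theorem moments_of_map_eq_pi_gaussianReal {Ω ι : Type*} [MeasurableSpace Ω] [Fintype ι]
    {μ : Measure Ω} {V : Ω → ι → ℝ} (hV : AEMeasurable V μ)
    (hlaw : μ.map V = Measure.pi fun _ => gaussianReal 0 1) (i : ι) :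
    MemLp (fun ω => V ω i) 2 μ ∧ ∫ ω, V ω i ∂μ = 0 ∧ Var[fun ω => V ω i; μ] = 1 ∧
      ∫ ω, V ω i ^ 2 ∂μ = 1 := by
  have hm : μ.map (fun ω => V ω i) = gaussianReal 0 1 := by
    have h := (measurePreserving_eval (fun _ : ι => gaussianReal 0 1) i).map_eq
    rw [← hlaw, AEMeasurable.map_map_of_aemeasurable
      (measurable_pi_apply i).aemeasurable hV] at h
    exact h
  have hVm : AEMeasurable (fun ω => V ω i) μ := (measurable_pi_apply i).comp_aemeasurable hV
  have h0 : ∫ ω, V ω i ∂μ = 0 := by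
    have h := integral_id_gaussianReal (μ := 0) (v := 1)
    rwa [← hm, integral_map hVm (by fun_prop)] at h
  have hv : Var[fun ω => V ω i; μ] = 1 := by
    have h := variance_fun_id_gaussianReal (μ := 0) (v := 1)
    rw [← hm, variance_map (by fun_prop) hVm] at h
    simpa [Function.comp_def] using h
  refine ⟨?_, h0, hv, ?_⟩
  · have h := memLp_id_gaussianReal' (μ := 0) (v := 1) 2 (by simp)
    rw [← hm] at h
    exact (memLp_map_measure_iff (by fun_prop) hVm).1 h
  · rw [variance_eq_integral hVm, h0] at hv
    simpa using hv

open InformationTheory in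
/-- The divergence of the joint law of `X` and `φ(X) + V`, with `V` a standard Gaussian vector
independent of `X`, from the product of the law of `X` and the Gaussian law of independent
coordinates with the means and variances of those of `φ(X) + V`. -/
theorem klDiv_gaussian_channel {Ω α ι : Type*} [MeasurableSpace Ω] [MeasurableSpace α] [Fintype ι]
    {μ : Measure Ω} [IsProbabilityMeasure μ] {X : Ω → α} {V : Ω → ι → ℝ} {φ : α → ι → ℝ}
    (hX : AEMeasurable X μ) (hV : AEMeasurable V μ) (hφ : Measurable φ)
    (hlaw : μ.map V = Measure.pi fun _ => gaussianReal 0 1) (hind : IndepFun X V μ)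
    (hL2 : ∀ i, MemLp (fun ω => φ (X ω) i) 2 μ) (D : ι → NNReal)
    (hD : ∀ i, (D i : ℝ) = Var[fun ω => φ (X ω) i; μ] + 1) (b : ι → ℝ)
    (hb : ∀ i, b i = ∫ ω, φ (X ω) i ∂μ) :
    klDiv (μ.map fun ω => (X ω, φ (X ω) + V ω))
        ((μ.map X).prod (Measure.pi fun i => gaussianReal (b i) (D i))) ≠ ∞ ∧
      (klDiv (μ.map fun ω => (X ω, φ (X ω) + V ω))
        ((μ.map X).prod (Measure.pi fun i => gaussianReal (b i) (D i)))).toReal =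
        1 / 2 * ∑ i, Real.log (D i) := by
  have := Measure.isProbabilityMeasure_map hX
  have hD0 : ∀ i, D i ≠ 0 := fun i h => by
    have h1 := hD i
    have h2 := variance_nonneg (fun ω => φ (X ω) i) μ
    rw [h] at h1
    simp at h1
    linarith
  have hdens := map_channel_eq_withDensity hX hV hφ hlaw hind b hD0
  have hVi := moments_of_map_eq_pi_gaussianReal hV hlaw
  have hφX : AEMeasurable (fun ω => φ (X ω)) μ := hφ.comp_aemeasurable hX
  have hXZ : AEMeasurable (fun ω => (X ω, φ (X ω) + V ω)) μ := hX.prodMk (hφX.add hV)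
  have := Measure.isProbabilityMeasure_map hXZ
  have hρm := measurable_channelDensity hφ b D
  have hac : μ.map (fun ω => (X ω, φ (X ω) + V ω)) ≪
      (μ.map X).prod (Measure.pi fun i => gaussianReal (b i) (D i)) := by
    rw [hdens]; exact withDensity_absolutelyContinuous _ _
  have hllr : llr (μ.map fun ω => (X ω, φ (X ω) + V ω))
      ((μ.map X).prod (Measure.pi fun i => gaussianReal (b i) (D i)))
      =ᵐ[μ.map fun ω => (X ω, φ (X ω) + V ω)] fun p => Real.log (channelDensity φ b D p) := by
    refine hac.ae_le ?_
    rw [hdens]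
    filter_upwards [Measure.rnDeriv_withDensity
      ((μ.map X).prod (Measure.pi fun i => gaussianReal (b i) (D i))) hρm.ennreal_ofReal] with p hp
    rw [llr, hp, ENNReal.toReal_ofReal (channelDensity_pos φ b hD0 p).le]
  -- The unit noise variance adds to that of `φ(X)` by independence, so the reference variance `D i`
  -- matches the output.
  have hcov : ∀ i, ∫ ω, (φ (X ω) i + V ω i - b i) ^ 2 ∂μ = D i := by
    intro i
    have hi : IndepFun (fun ω => φ (X ω) i) (fun ω => V ω i) μ :=
      hind.comp ((measurable_pi_apply i).comp hφ) (measurable_pi_apply i)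
    have hv := hi.variance_add (hL2 i) (hVi i).1
    have hmean : ∫ ω, (φ (X ω) i + V ω i) ∂μ = b i := by
      rw [integral_add ((hL2 i).integrable (by norm_num)) ((hVi i).1.integrable (by norm_num)),
        (hVi i).2.1, add_zero, hb]
    rw [variance_eq_integral ((hL2 i).add (hVi i).1).aemeasurable, (hVi i).2.2.1] at hv
    simp only [Pi.add_apply] at hv
    rw [hmean] at hv
    rw [hv, hD i]
  -- The output minus `φ(X)` is `V`, so only quadratic terms occur. In the mean, the first
  -- contributes `-1/2` and the second `+1/2`, leaving `½ log D i` per coordinate.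
  have hlog : ∀ ω, Real.log (channelDensity φ b D (X ω, φ (X ω) + V ω)) =
      ∑ i, (-(V ω i) ^ 2 / 2 + (φ (X ω) i + V ω i - b i) ^ 2 / (2 * D i) +
        1 / 2 * Real.log (D i)) := by
    intro ω
    rw [channelDensity, Real.log_prod fun i _ => (gaussianRatio_pos _ _ (hD0 i) _).ne']
    refine Finset.sum_congr rfl fun i _ => ?_
    rw [log_gaussianRatio _ _ (hD0 i)]
    simp
  have hI1 : ∀ i, Integrable (fun ω => -(V ω i) ^ 2 / 2) μ := fun i =>
    (hVi i).1.integrable_sq.neg.div_const 2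
  have hI2 : ∀ i, Integrable (fun ω => (φ (X ω) i + V ω i - b i) ^ 2 / (2 * D i)) μ := fun i =>
    (((hL2 i).add (hVi i).1).sub (memLp_const (b i))).integrable_sq.div_const _
  have hI : ∀ i, Integrable (fun ω => -(V ω i) ^ 2 / 2 +
      (φ (X ω) i + V ω i - b i) ^ 2 / (2 * D i) + 1 / 2 * Real.log (D i)) μ := fun i =>
    ((hI1 i).add (hI2 i)).add (integrable_const _)
  have hint : Integrable (fun p => Real.log (channelDensity φ b D p))
      (μ.map fun ω => (X ω, φ (X ω) + V ω)) := by
    rw [integrable_map_measure hρm.log.aestronglyMeasurable hXZ]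
    simp only [Function.comp_def, hlog]
    exact integrable_finsetSum _ fun i _ => hI i
  refine ⟨klDiv_ne_top hac (hint.congr hllr.symm), ?_⟩
  rw [toReal_klDiv_of_measure_eq hac (by simp), integral_congr_ae hllr,
    integral_map hXZ hρm.log.aestronglyMeasurable]
  simp only [hlog]
  rw [integral_finsetSum _ fun i _ => hI i, Finset.mul_sum]
  refine Finset.sum_congr rfl fun i _ => ?_
  have hI12 : Integrable (fun ω => -(V ω i) ^ 2 / 2 +
      (φ (X ω) i + V ω i - b i) ^ 2 / (2 * D i)) μ := (hI1 i).add (hI2 i)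
  rw [integral_add hI12 (integrable_const _), integral_add (hI1 i) (hI2 i),
    integral_div, integral_div, integral_neg, (hVi i).2.2.2, hcov i]
  have : (D i : ℝ) ≠ 0 := by exact_mod_cast hD0 i
  simp
  field_simp
  ring

/-! ### Whitening and the Gaussian bound on information -/

/-- A Gaussian vector with uncorrelated centered coordinates of variance `1` is standard. -/
theorem map_eq_pi_gaussianReal {Ω ι : Type*} [MeasurableSpace Ω] [Fintype ι] [DecidableEq ι]
    {μ : Measure Ω} {V : Ω → ι → ℝ} (hV : HasGaussianLaw V μ)
    (hmean : ∀ i, ∫ ω, V ω i ∂μ = 0)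
    (hcov : ∀ i j, cov[fun ω => V ω i, fun ω => V ω j; μ] = if i = j then 1 else 0) :
    μ.map V = Measure.pi fun _ => gaussianReal 0 1 := by
  have := hV.isProbabilityMeasure
  have hVm := hV.aemeasurable
  have hi : ∀ i, HasGaussianLaw (fun ω => V ω i) μ := fun i =>
    HasGaussianLaw.eval (X := fun i ω => V ω i) hV i
  have hind : iIndepFun (fun i ω => V ω i) μ :=
    HasGaussianLaw.iIndepFun_of_covariance_eq_zero hV fun i j hij => by rw [hcov, if_neg hij]
  rw [show V = fun ω i => V ω i from rfl,
    (iIndepFun_iff_map_fun_eq_pi_map fun i => (hi i).aemeasurable).1 hind]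
  congr 1
  ext1 i
  rw [(hi i).map_eq_gaussianReal, hmean i, ← covariance_self (hi i).aemeasurable, hcov, if_pos rfl,
    Real.toNNReal_one]

open scoped MatrixOrder Matrix.Norms.L2Operator in
/-- A positive definite and a symmetric matrix are simultaneously diagonalized by a congruence. -/
theorem exists_simultaneous_diagonalization {ι : Type*} [Fintype ι] [DecidableEq ι]
    {W S : Matrix ι ι ℝ} (hW : W.PosDef) (hS : S.IsHermitian) :
    ∃ (T : Matrix ι ι ℝ) (d : ι → ℝ), T * W * Tᵀ = 1 ∧ T * S * Tᵀ = Matrix.diagonal d := by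
  -- With `W = Bᵀ B`, the matrix `(Bᵀ)⁻¹ S B⁻¹` is symmetric; if the orthogonal `Q` diagonalizes it,
  -- then `T = Qᵀ (Bᵀ)⁻¹` serves both purposes.
  obtain ⟨B, hB⟩ := CStarAlgebra.nonneg_iff_eq_star_mul_self.1 hW.posSemidef.nonneg
  rw [Matrix.star_eq_conjTranspose, Matrix.conjTranspose_eq_transpose_of_trivial] at hB
  have hBdet : IsUnit B.det := by
    have h := hW.det_pos
    rw [hB, Matrix.det_mul, Matrix.det_transpose] at h
    exact isUnit_iff_ne_zero.2 (left_ne_zero_of_mul h.ne')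
  have hBT : IsUnit (Bᵀ).det := by rwa [Matrix.det_transpose]
  have hC : ((Bᵀ)⁻¹ * S * ((Bᵀ)⁻¹)ᵀ).IsHermitian := by
    have h := Matrix.isHermitian_mul_mul_conjTranspose (Bᵀ)⁻¹ hS
    rwa [Matrix.conjTranspose_eq_transpose_of_trivial] at h
  set Q : Matrix ι ι ℝ := hC.eigenvectorUnitary.1
  have hQ1 : Qᵀ * Q = 1 := by
    have h := Unitary.coe_star_mul_self hC.eigenvectorUnitary
    rwa [Matrix.star_eq_conjTranspose, Matrix.conjTranspose_eq_transpose_of_trivial] at h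
  have hspec : (Bᵀ)⁻¹ * S * ((Bᵀ)⁻¹)ᵀ = Q * Matrix.diagonal hC.eigenvalues * Qᵀ := by
    have h := hC.spectral_theorem
    rw [Unitary.conjStarAlgAut_apply, Matrix.star_eq_conjTranspose,
      Matrix.conjTranspose_eq_transpose_of_trivial] at h
    exact h
  refine ⟨Qᵀ * (Bᵀ)⁻¹, hC.eigenvalues, ?_, ?_⟩
  · have h1 : (Bᵀ)⁻¹ * (Bᵀ * B) * ((Bᵀ)⁻¹)ᵀ = 1 := by
      rw [← Matrix.mul_assoc, Matrix.nonsing_inv_mul _ hBT, Matrix.one_mul,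
        Matrix.transpose_nonsing_inv, Matrix.transpose_transpose, Matrix.mul_nonsing_inv _ hBdet]
    calc Qᵀ * (Bᵀ)⁻¹ * W * (Qᵀ * (Bᵀ)⁻¹)ᵀ
        = Qᵀ * ((Bᵀ)⁻¹ * (Bᵀ * B) * ((Bᵀ)⁻¹)ᵀ) * Q := by
          rw [← hB, Matrix.transpose_mul, Matrix.transpose_transpose]
          simp only [Matrix.mul_assoc]
      _ = 1 := by rw [h1, Matrix.mul_one, hQ1]
  · calc Qᵀ * (Bᵀ)⁻¹ * S * (Qᵀ * (Bᵀ)⁻¹)ᵀ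
        = Qᵀ * ((Bᵀ)⁻¹ * S * ((Bᵀ)⁻¹)ᵀ) * Q := by
          rw [Matrix.transpose_mul, Matrix.transpose_transpose]
          simp only [Matrix.mul_assoc]
      _ = (Qᵀ * Q) * Matrix.diagonal hC.eigenvalues * (Qᵀ * Q) := by
          refine (congrArg (fun C => Qᵀ * C * Q) hspec).trans ?_
          simp only [Matrix.mul_assoc]
      _ = _ := by rw [hQ1, Matrix.one_mul, Matrix.mul_one]

/-- The matrix of the covariances of the coordinates of a random vector. -/
noncomputable def covarianceMatrix {Ω ι : Type*} [MeasurableSpace Ω] (μ : Measure Ω)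
    (Y : Ω → ι → ℝ) : Matrix ι ι ℝ :=
  Matrix.of fun i j => cov[fun ω => Y ω i, fun ω => Y ω j; μ]

theorem covarianceMatrix_isHermitian {Ω ι : Type*} [MeasurableSpace Ω] (μ : Measure Ω)
    (Y : Ω → ι → ℝ) : (covarianceMatrix μ Y).IsHermitian := by
  ext i j
  simp [covarianceMatrix, covariance_comm]

theorem covarianceMatrix_mulVec {Ω ι κ : Type*} [MeasurableSpace Ω] [Fintype ι] {μ : Measure Ω}
    [IsFiniteMeasure μ] {Y : Ω → ι → ℝ} (hY : ∀ i, MemLp (fun ω => Y ω i) 2 μ)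
    (A : Matrix κ ι ℝ) :
    covarianceMatrix μ (fun ω => A *ᵥ Y ω) = A * covarianceMatrix μ Y * Aᵀ := by
  ext i j
  simp only [covarianceMatrix, Matrix.of_apply, Matrix.mulVec, dotProduct]
  rw [covariance_fun_sum_fun_sum (fun l => (hY l).const_mul (A i l))
    fun l => (hY l).const_mul (A j l)]
  simp only [Matrix.mul_apply, Matrix.of_apply, Matrix.transpose_apply, covariance_const_mul_left,
    covariance_const_mul_right, Finset.sum_mul]
  rw [Finset.sum_comm]
  refine Finset.sum_congr rfl fun p _ => Finset.sum_congr rfl fun q _ => ?_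
  ring

theorem covarianceMatrix_add_const {Ω ι : Type*} [MeasurableSpace Ω] {μ : Measure Ω}
    [IsProbabilityMeasure μ] {Y : Ω → ι → ℝ} (hY : ∀ i, MemLp (fun ω => Y ω i) 2 μ) (c : ι → ℝ) :
    covarianceMatrix μ (fun ω => Y ω + c) = covarianceMatrix μ Y := by
  ext i j
  simp only [covarianceMatrix, Matrix.of_apply, Pi.add_apply]
  rw [covariance_add_const_left ((hY i).integrable (by norm_num)),
    covariance_add_const_right ((hY j).integrable (by norm_num))]

theorem memLp_mulVec {Ω ι κ : Type*} [MeasurableSpace Ω] [Fintype ι] {μ : Measure Ω}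
    {Y : Ω → ι → ℝ} (hY : ∀ i, MemLp (fun ω => Y ω i) 2 μ) (A : Matrix κ ι ℝ) (i : κ) :
    MemLp (fun ω => (A *ᵥ Y ω) i) 2 μ :=
  memLp_finsetSum _ fun l _ => (hY l).const_mul (A i l)

/-- The information about `X` carried by `φ(X) + N`, for a Gaussian `N` independent of `X`, is at
most the Gaussian value determined by the covariances of `φ(X) + N` and `N`. -/
theorem mutualInfo_add_gaussian_le {Ω α ι : Type*} [MeasurableSpace Ω] [MeasurableSpace α]
    [StandardBorelSpace α] [Nonempty α] [Fintype ι] [DecidableEq ι]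
    {μ : Measure Ω} [IsProbabilityMeasure μ] {X : Ω → α} {N : Ω → ι → ℝ} {φ : α → ι → ℝ}
    (hX : AEMeasurable X μ) (hφ : Measurable φ) (hL2 : ∀ i, MemLp (fun ω => φ (X ω) i) 2 μ)
    (hN : HasGaussianLaw N μ) (hmean : ∀ i, ∫ ω, N ω i ∂μ = 0)
    (hpos : (covarianceMatrix μ N).PosDef) (hind : IndepFun X N μ) :
    mutualInfo μ X (fun ω => φ (X ω) + N ω) ≠ ∞ ∧
      (mutualInfo μ X (fun ω => φ (X ω) + N ω)).toReal ≤ 1 / 2 * Real.log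
        ((covarianceMatrix μ fun ω => φ (X ω) + N ω).det / (covarianceMatrix μ N).det) := by
  -- In the coordinates given by `T` the noise is standard and the output uncorrelated, so the
  -- reference law can be a product.
  obtain ⟨T, d, hTN, hTZ⟩ := exists_simultaneous_diagonalization hpos
    (covarianceMatrix_isHermitian μ fun ω => φ (X ω) + N ω)
  have hN2 : ∀ i, MemLp (fun ω => N ω i) 2 μ := fun i =>
    (HasGaussianLaw.eval (X := fun i ω => N ω i) hN i).memLp_two
  have hZ2 : ∀ i, MemLp (fun ω => (φ (X ω) + N ω) i) 2 μ := fun i => (hL2 i).add (hN2 i)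
  set V : Ω → ι → ℝ := fun ω => T *ᵥ N ω with hVdef
  set ψ : α → ι → ℝ := fun x => T *ᵥ φ x with hψdef
  have hTmeas : ∀ A : Matrix ι ι ℝ, Measurable fun v : ι → ℝ => A *ᵥ v := fun A =>
    (LinearMap.continuous_of_finiteDimensional A.mulVecLin).measurable
  have hψ : Measurable ψ := (hTmeas T).comp hφ
  have hVg : HasGaussianLaw V μ :=
    hN.map_fun (LinearMap.toContinuousLinearMap T.mulVecLin)
  have hVcov : covarianceMatrix μ V = 1 := by
    rw [hVdef, covarianceMatrix_mulVec hN2, hTN]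
  have hVmean : ∀ i, ∫ ω, V ω i ∂μ = 0 := fun i => by
    simp only [hVdef, Matrix.mulVec, dotProduct]
    rw [integral_finsetSum _ fun l _ => ((hN2 l).const_mul (T i l)).integrable (by norm_num)]
    simp [integral_const_mul, hmean]
  have hVlaw := map_eq_pi_gaussianReal hVg hVmean fun i j => by
    have h := congrFun (congrFun hVcov i) j
    rwa [Matrix.one_apply] at h
  have hindV : IndepFun X V μ := hind.comp measurable_id (hTmeas T)
  have hψ2 : ∀ i, MemLp (fun ω => ψ (X ω) i) 2 μ := memLp_mulVec hL2 T
  have hsum : (fun ω => ψ (X ω) + V ω) = fun ω => T *ᵥ (φ (X ω) + N ω) := by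
    ext1 ω; rw [Matrix.mulVec_add]
  have hd : ∀ i, d i = Var[fun ω => ψ (X ω) i; μ] + 1 := by
    intro i
    have h1 : cov[fun ω => (ψ (X ω) + V ω) i, fun ω => (ψ (X ω) + V ω) i; μ] = d i := by
      have h := congrFun (congrFun hTZ i) i
      rw [← covarianceMatrix_mulVec hZ2, ← hsum, Matrix.diagonal_apply_eq] at h
      exact h
    have hVi := moments_of_map_eq_pi_gaussianReal hVg.aemeasurable hVlaw i
    have hiV : IndepFun (fun ω => ψ (X ω) i) (fun ω => V ω i) μ :=
      hindV.comp ((measurable_pi_apply i).comp hψ) (measurable_pi_apply i)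
    have h2 := hiV.variance_add (hψ2 i) hVi.1
    rw [hVi.2.2.1] at h2
    exact (h1.symm.trans (covariance_self ((hψ2 i).add hVi.1).aemeasurable)).trans h2
  have hdpos : ∀ i, 0 < d i := fun i => by
    rw [hd i]; have := variance_nonneg (fun ω => ψ (X ω) i) μ; linarith
  set D : ι → NNReal := fun i => ⟨d i, (hdpos i).le⟩
  have hkl := klDiv_gaussian_channel hX hVg.aemeasurable hψ hVlaw hindV hψ2
    D (fun i => hd i) (fun i => ∫ ω, ψ (X ω) i ∂μ) fun i => rfl
  -- Both determinants pick up the same factor `|T|²`, so their ratio does not see `T`; this also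
  -- shows that `T` is invertible.
  have hdetN : T.det * (covarianceMatrix μ N).det * T.det = 1 := by
    rw [← Matrix.det_one (n := ι) (R := ℝ), ← hTN]; simp
  have hdetZ : T.det * (covarianceMatrix μ fun ω => φ (X ω) + N ω).det * T.det = ∏ i, d i := by
    rw [← Matrix.det_diagonal, ← hTZ]; simp
  have hT0 : T.det ≠ 0 := fun h => by simp [h] at hdetN
  have hratio : (covarianceMatrix μ fun ω => φ (X ω) + N ω).det / (covarianceMatrix μ N).det =
      ∏ i, d i := by
    rw [div_eq_iff hpos.det_pos.ne', ← hdetZ]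
    linear_combination
      -(covarianceMatrix μ fun ω => φ (X ω) + N ω).det * hdetN
  have hZm : AEMeasurable (fun ω => ψ (X ω) + V ω) μ :=
    (hψ.comp_aemeasurable hX).add hVg.aemeasurable
  have hback : (fun ω => φ (X ω) + N ω) = fun ω => T⁻¹ *ᵥ (ψ (X ω) + V ω) := by
    ext1 ω
    rw [congrFun hsum ω, Matrix.mulVec_mulVec,
      Matrix.nonsing_inv_mul _ (isUnit_iff_ne_zero.2 hT0), Matrix.one_mulVec]
  -- Only an upper bound is needed, so data processing under `T⁻¹` replaces invariance under the
  -- change of coordinates.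
  have hle : mutualInfo μ X (fun ω => φ (X ω) + N ω) ≤ _ :=
    (hback ▸ mutualInfo_comp_right_le hX hZm (hTmeas T⁻¹)).trans
      (mutualInfo_le_klDiv_prod hX hZm
        (Measure.pi fun i => gaussianReal (∫ ω, ψ (X ω) i ∂μ) (D i)))
  refine ⟨ne_top_of_le_ne_top hkl.1 hle, (ENNReal.toReal_mono hkl.1 hle).trans ?_⟩
  rw [hkl.2, hratio, Real.log_prod fun i _ => (hdpos i).ne']
  rfl

/-! ### Calculus of second-moment matrices -/

section SecondOrder

variable {Ω : Type*} [MeasurableSpace Ω] {μ : Measure Ω}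

theorem expOuter_transpose {a b : ℕ} (X : Ω → Fin a → ℝ) (Y : Ω → Fin b → ℝ) :
    (expOuter μ X Y)ᵀ = expOuter μ Y X := by
  ext i j
  simp only [expOuter, Matrix.transpose_apply, Matrix.of_apply, mul_comm]

theorem expOuter_add_left {a b : ℕ} {X X' : Ω → Fin a → ℝ} {Y : Ω → Fin b → ℝ}
    (hX : MemLp X 2 μ) (hX' : MemLp X' 2 μ) (hY : MemLp Y 2 μ) :
    expOuter μ (fun ω => X ω + X' ω) Y = expOuter μ X Y + expOuter μ X' Y := by
  ext i j
  simp only [expOuter, Matrix.of_apply, Matrix.add_apply, Pi.add_apply, add_mul]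
  exact integral_add ((hX.eval i).integrable_mul (hY.eval j))
    ((hX'.eval i).integrable_mul (hY.eval j))

theorem expOuter_mulVec_left {a b c : ℕ} {X : Ω → Fin a → ℝ} {Y : Ω → Fin b → ℝ}
    (hX : MemLp X 2 μ) (hY : MemLp Y 2 μ) (A : Matrix (Fin c) (Fin a) ℝ) :
    expOuter μ (fun ω => A *ᵥ X ω) Y = A * expOuter μ X Y := by
  ext i j
  simp only [expOuter, Matrix.of_apply, Matrix.mul_apply, Matrix.mulVec, dotProduct,
    Finset.sum_mul, mul_assoc]
  have hint : ∀ l, Integrable (fun ω => A i l * (X ω l * Y ω j)) μ := fun l =>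
    ((hX.eval l).integrable_mul (hY.eval j)).const_mul _
  rw [integral_finsetSum _ fun l _ => hint l]
  exact Finset.sum_congr rfl fun l _ => integral_const_mul _ _

theorem expOuter_sub_left {a b : ℕ} {X X' : Ω → Fin a → ℝ} {Y : Ω → Fin b → ℝ}
    (hX : MemLp X 2 μ) (hX' : MemLp X' 2 μ) (hY : MemLp Y 2 μ) :
    expOuter μ (fun ω => X ω - X' ω) Y = expOuter μ X Y - expOuter μ X' Y := by
  ext i j
  simp only [expOuter, Matrix.of_apply, Matrix.sub_apply, Pi.sub_apply, sub_mul]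
  exact integral_sub ((hX.eval i).integrable_mul (hY.eval j))
    ((hX'.eval i).integrable_mul (hY.eval j))

theorem expOuter_add_right {a b : ℕ} {X : Ω → Fin a → ℝ} {Y Y' : Ω → Fin b → ℝ}
    (hX : MemLp X 2 μ) (hY : MemLp Y 2 μ) (hY' : MemLp Y' 2 μ) :
    expOuter μ X (fun ω => Y ω + Y' ω) = expOuter μ X Y + expOuter μ X Y' := by
  rw [← expOuter_transpose, expOuter_add_left hY hY' hX, Matrix.transpose_add,
    expOuter_transpose, expOuter_transpose]

theorem expOuter_sub_right {a b : ℕ} {X : Ω → Fin a → ℝ} {Y Y' : Ω → Fin b → ℝ}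
    (hX : MemLp X 2 μ) (hY : MemLp Y 2 μ) (hY' : MemLp Y' 2 μ) :
    expOuter μ X (fun ω => Y ω - Y' ω) = expOuter μ X Y - expOuter μ X Y' := by
  rw [← expOuter_transpose, expOuter_sub_left hY hY' hX, Matrix.transpose_sub,
    expOuter_transpose, expOuter_transpose]

theorem expOuter_mulVec_right {a b c : ℕ} {X : Ω → Fin a → ℝ} {Y : Ω → Fin b → ℝ}
    (hX : MemLp X 2 μ) (hY : MemLp Y 2 μ) (A : Matrix (Fin c) (Fin b) ℝ) :
    expOuter μ X (fun ω => A *ᵥ Y ω) = expOuter μ X Y * Aᵀ := by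
  rw [← expOuter_transpose, expOuter_mulVec_left hY hX, Matrix.transpose_mul, expOuter_transpose]

theorem expOuter_const_right {a b : ℕ} {X : Ω → Fin a → ℝ} (hX : ∀ i, ∫ ω, X ω i ∂μ = 0)
    (c : Fin b → ℝ) : expOuter μ X (fun _ => c) = 0 := by
  ext i j
  simp [expOuter, integral_mul_const, hX]

theorem memLp_two_mulVec {a b : ℕ} {X : Ω → Fin a → ℝ} (hX : MemLp X 2 μ)
    (A : Matrix (Fin b) (Fin a) ℝ) : MemLp (fun ω => A *ᵥ X ω) 2 μ :=
  MemLp.of_eval fun i => memLp_mulVec (fun l => hX.eval l) A i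

/-- The quadratic form at `v` is the second moment of `v · X`. -/
theorem expOuter_self_posSemidef {a : ℕ} {X : Ω → Fin a → ℝ} (hX : MemLp X 2 μ) :
    (expOuter μ X X).PosSemidef := by
  refine Matrix.PosSemidef.of_dotProduct_mulVec_nonneg ?_ fun v => ?_
  · rw [Matrix.IsHermitian, Matrix.conjTranspose_eq_transpose_of_trivial, expOuter_transpose]
  · have h : star v ⬝ᵥ (expOuter μ X X *ᵥ v) = ∫ ω, (∑ i, v i * X ω i) ^ 2 ∂μ := by
      have h1 : ∀ ω, (∑ i, v i * X ω i) ^ 2 = ∑ i, ∑ j, v i * v j * (X ω i * X ω j) := by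
        intro ω
        rw [sq, Finset.sum_mul_sum]
        exact Finset.sum_congr rfl fun i _ => Finset.sum_congr rfl fun j _ => by ring
      have hint : ∀ i j, Integrable (fun ω => v i * v j * (X ω i * X ω j)) μ := fun i j =>
        ((hX.eval i).integrable_mul (hX.eval j)).const_mul _
      simp_rw [h1]
      rw [integral_finsetSum _ fun i _ => integrable_finsetSum _ fun j _ => hint i j]
      simp only [dotProduct, Matrix.mulVec, Pi.star_apply, star_trivial, Finset.mul_sum]
      refine Finset.sum_congr rfl fun i _ => ?_
      rw [integral_finsetSum _ fun j _ => hint i j]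
      refine Finset.sum_congr rfl fun j _ => ?_
      rw [integral_const_mul, expOuter, Matrix.of_apply]
      ring
    rw [h]
    exact integral_nonneg fun ω => sq_nonneg _

theorem expOuter_eq_zero_of_indepFun {a b : ℕ} {X : Ω → Fin a → ℝ} {Y : Ω → Fin b → ℝ}
    (hX : AEMeasurable X μ) (hY : AEMeasurable Y μ) (h : IndepFun X Y μ)
    (hY0 : ∀ j, ∫ ω, Y ω j ∂μ = 0) : expOuter μ X Y = 0 := by
  ext i j
  have hij : IndepFun (fun ω => X ω i) (fun ω => Y ω j) μ :=
    h.comp (measurable_pi_apply i) (measurable_pi_apply j)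
  have := hij.integral_mul_eq_mul_integral
    ((measurable_pi_apply i).comp_aemeasurable hX).aestronglyMeasurable
    ((measurable_pi_apply j).comp_aemeasurable hY).aestronglyMeasurable
  simp only [Pi.mul_apply] at this
  simp [expOuter, this, hY0]

end SecondOrder

/-! ### Linear estimators and orthogonality -/

section LinearEstimators

variable {Ω : Type*} {n m : ℕ} {z : ℕ → Ω → Fin m → ℝ}

theorem linearEstimator_zero_coeff (r : ℕ) (a : Fin n → ℝ) :
    linearEstimator z r a (fun _ => 0) = fun _ => a := by
  ext ω i
  simp [linearEstimator]

theorem linearEstimator_add (r : ℕ) (a a' : Fin n → ℝ) (A A' : ℕ → Matrix (Fin n) (Fin m) ℝ) :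
    (fun ω => linearEstimator z r a A ω + linearEstimator z r a' A' ω) =
      linearEstimator z r (a + a') (A + A') := by
  ext1 ω
  simp only [linearEstimator, Pi.add_apply, Matrix.add_mulVec, Finset.sum_add_distrib]
  abel

theorem linearEstimator_mulVec {p : ℕ} (B : Matrix (Fin p) (Fin n) ℝ) (r : ℕ) (a : Fin n → ℝ)
    (A : ℕ → Matrix (Fin n) (Fin m) ℝ) :
    (fun ω => B *ᵥ linearEstimator z r a A ω) =
      linearEstimator z r (B *ᵥ a) fun l => B * A l := by
  ext1 ω
  simp only [linearEstimator, Matrix.mulVec_add, Matrix.mulVec_sum, Matrix.mulVec_mulVec]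

theorem linearEstimator_sub (r : ℕ) (a a' : Fin n → ℝ) (A A' : ℕ → Matrix (Fin n) (Fin m) ℝ) :
    (fun ω => linearEstimator z r a A ω - linearEstimator z r a' A' ω) =
      linearEstimator z r (a - a') (A - A') := by
  ext1 ω
  simp only [linearEstimator, Pi.sub_apply, Matrix.sub_mulVec, Finset.sum_sub_distrib]
  abel

theorem linearEstimator_succ (r : ℕ) (a : Fin n → ℝ) (A : ℕ → Matrix (Fin n) (Fin m) ℝ) :
    linearEstimator z (r + 1) a A = fun ω => linearEstimator z r a A ω + A r *ᵥ z r ω := by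
  ext1 ω
  simp only [linearEstimator, Finset.sum_range_succ]
  abel

theorem linearEstimator_congr {r : ℕ} (a : Fin n → ℝ) {A A' : ℕ → Matrix (Fin n) (Fin m) ℝ}
    (h : ∀ l < r, A l = A' l) : linearEstimator z r a A = linearEstimator z r a A' := by
  ext1 ω
  simp only [linearEstimator]
  congr 1
  exact Finset.sum_congr rfl fun l hl => by rw [h l (Finset.mem_range.1 hl)]

/-- A linear estimator from `r` observations plus a linear function of the next one. -/
theorem linearEstimator_add_obs (r : ℕ) (a : Fin n → ℝ) (A : ℕ → Matrix (Fin n) (Fin m) ℝ)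
    (K : Matrix (Fin n) (Fin m) ℝ) :
    (fun ω => linearEstimator z r a A ω + K *ᵥ z r ω) =
      linearEstimator z (r + 1) a (Function.update A r K) := by
  rw [linearEstimator_succ, Function.update_self,
    linearEstimator_congr a fun l hl => Function.update_of_ne hl.ne K A]

variable [MeasurableSpace Ω] {μ : Measure Ω}

theorem memLp_linearEstimator [IsFiniteMeasure μ] (hz : ∀ l, MemLp (z l) 2 μ) (r : ℕ)
    (a : Fin n → ℝ) (A : ℕ → Matrix (Fin n) (Fin m) ℝ) : MemLp (linearEstimator z r a A) 2 μ :=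
  (memLp_const a).add (memLp_finsetSum _ fun l _ => memLp_two_mulVec (hz l) (A l))

/-- Orthogonality to each observation extends by linearity; the zero mean takes care of the constant
term. -/
theorem expOuter_linearEstimator_eq_zero [IsFiniteMeasure μ] {p : ℕ} {Y : Ω → Fin p → ℝ}
    (hY : MemLp Y 2 μ) (hz : ∀ l, MemLp (z l) 2 μ) (hY0 : ∀ i, ∫ ω, Y ω i ∂μ = 0) {r : ℕ}
    (hYz : ∀ l < r, expOuter μ Y (z l) = 0) (a : Fin n → ℝ)
    (A : ℕ → Matrix (Fin n) (Fin m) ℝ) : expOuter μ Y (linearEstimator z r a A) = 0 := by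
  induction r with
  | zero =>
    have : linearEstimator z 0 a A = fun _ => a := by ext ω i; simp [linearEstimator]
    rw [this, expOuter_const_right hY0]
  | succ r ih =>
    rw [linearEstimator_succ, expOuter_add_right hY (memLp_linearEstimator hz r a A)
      (memLp_two_mulVec (hz r) _), ih fun l hl => hYz l (hl.trans r.lt_succ_self),
      expOuter_mulVec_right hY (hz r), hYz r r.lt_succ_self]
    simp

/-- **Orthogonality principle**: the error of a linear least-squares estimate is orthogonal to
every linear estimator from the same observations. -/
theorem IsLinearLeastSquares.expOuter_eq_zero [IsFiniteMeasure μ] {p r : ℕ}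
    {s t : Ω → Fin n → ℝ} (h : IsLinearLeastSquares μ z r s t) (hs : MemLp s 2 μ)
    (hz : ∀ l, MemLp (z l) 2 μ) (a : Fin p → ℝ) (A : ℕ → Matrix (Fin p) (Fin m) ℝ) :
    expOuter μ (fun ω => s ω - t ω) (linearEstimator z r a A) = 0 := by
  obtain ⟨⟨a₀, A₀, ht⟩, hmin⟩ := h
  have ht2 : MemLp t 2 μ := ht ▸ memLp_linearEstimator hz r a₀ A₀
  have hy2 := memLp_linearEstimator hz r a A
  ext i j
  set e : Ω → ℝ := fun ω => s ω i - t ω i with he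
  set y : Ω → ℝ := fun ω => linearEstimator z r a A ω j with hy
  have he2 : MemLp e 2 μ := (hs.eval i).sub (ht2.eval i)
  have hy2' : MemLp y 2 μ := hy2.eval j
  have hrest : ∀ l, Integrable (fun ω => (s ω l - t ω l) ^ 2) μ := fun l =>
    ((hs.eval l).sub (ht2.eval l)).integrable_sq
  -- Adding `ε y` to coordinate `i` of the estimate gives another admissible estimator. Minimality
  -- makes this quadratic in `ε` nonnegative; having no constant term, it has discriminant `4 E[e
  -- y]²`, which must vanish.
  have key : ∀ ε : ℝ, 0 ≤ (∫ ω, y ω ^ 2 ∂μ) * (ε * ε) + (-2 * ∫ ω, e ω * y ω ∂μ) * ε + 0 := by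
    intro ε
    set B : Matrix (Fin n) (Fin p) ℝ := Matrix.single i j ε with hB
    have hle := hmin (a₀ + B *ᵥ a) (A₀ + fun l => B * A l)
    rw [← linearEstimator_add, ← linearEstimator_mulVec, ← ht] at hle
    have hBv : ∀ ω l, (B *ᵥ linearEstimator z r a A ω) l = if l = i then ε * y ω else 0 := by
      intro ω l
      rw [hB, Matrix.single_mulVec, Function.update_apply]
      rfl
    have hpt : ∀ ω, ∑ l, (s ω l - (t ω + B *ᵥ linearEstimator z r a A ω) l) ^ 2 =
        ∑ l, (s ω l - t ω l) ^ 2 + (ε * ε * y ω ^ 2 - 2 * ε * (e ω * y ω)) := by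
      intro ω
      rw [← sub_eq_iff_eq_add', ← Finset.sum_sub_distrib, Finset.sum_eq_single i]
      · simp only [Pi.add_apply, hBv, if_true, he]; ring
      · intro l _ hl; simp [hBv, hl]
      · simp
    simp only [meanSquareError, hpt] at hle
    have hi1 : Integrable (fun ω => ε * ε * y ω ^ 2) μ := hy2'.integrable_sq.const_mul _
    have hi2 : Integrable (fun ω => 2 * ε * (e ω * y ω)) μ :=
      (he2.integrable_mul hy2').const_mul _
    have hi12 : Integrable (fun ω => ε * ε * y ω ^ 2 - 2 * ε * (e ω * y ω)) μ := hi1.sub hi2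
    rw [integral_add (integrable_finsetSum _ fun l _ => hrest l) hi12,
      integral_sub hi1 hi2, integral_const_mul, integral_const_mul] at hle
    linarith
  have hd := discrim_le_zero key
  simp only [discrim, mul_zero, sub_zero] at hd
  have : (-2 * ∫ ω, e ω * y ω ∂μ) = 0 := pow_eq_zero_iff (two_ne_zero) |>.1
    (le_antisymm hd (sq_nonneg _))
  simp only [expOuter, Matrix.of_apply, Matrix.zero_apply, Pi.sub_apply]
  change ∫ ω, e ω * y ω ∂μ = 0
  linarith

/-- The error covariance of a linear least-squares estimate is that of any linear estimator whose
error is orthogonal to the linear estimators. -/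
theorem IsLinearLeastSquares.errorCov_eq [IsFiniteMeasure μ] {r : ℕ}
    {s t : Ω → Fin n → ℝ} (h : IsLinearLeastSquares μ z r s t) (hs : MemLp s 2 μ)
    (hz : ∀ l, MemLp (z l) 2 μ) {t' : Ω → Fin n → ℝ}
    (ht' : ∃ a A, t' = linearEstimator z r a A)
    (horth : ∀ (a : Fin n → ℝ) A,
      expOuter μ (fun ω => s ω - t' ω) (linearEstimator z r a A) = 0) :
    errorCov μ s t = errorCov μ s t' := by
  obtain ⟨a, A, ht⟩ := h.1
  obtain ⟨a', A', ht'⟩ := ht'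
  have ht2 : MemLp t 2 μ := ht ▸ memLp_linearEstimator hz r a A
  have ht2' : MemLp t' 2 μ := ht' ▸ memLp_linearEstimator hz r a' A'
  have he : MemLp (fun ω => s ω - t ω) 2 μ := hs.sub ht2
  have he' : MemLp (fun ω => s ω - t' ω) 2 μ := hs.sub ht2'
  -- The difference of the two estimates is itself a linear estimator, so it is orthogonal to both
  -- errors and the cross terms drop out.
  have h1 : expOuter μ (fun ω => s ω - t ω) (fun ω => t ω - t' ω) = 0 := by
    rw [ht', ht, linearEstimator_sub, ← ht]
    exact h.expOuter_eq_zero hs hz _ _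
  have h2 : expOuter μ (fun ω => s ω - t' ω) (fun ω => t ω - t' ω) = 0 := by
    rw [ht', ht, linearEstimator_sub, ← ht']
    exact horth _ _
  have hdecomp : (fun ω => s ω - t' ω) = fun ω => (s ω - t ω) + (t ω - t' ω) := by
    ext1 ω; abel
  have hd : MemLp (fun ω => t ω - t' ω) 2 μ := ht2.sub ht2'
  have h3 : errorCov μ s t' = expOuter μ (fun ω => s ω - t' ω) (fun ω => s ω - t ω) := by
    rw [errorCov]
    nth_rewrite 2 [hdecomp]
    rw [expOuter_add_right he' he hd, h2, add_zero]
  rw [h3, hdecomp, expOuter_add_left he hd he, ← expOuter_transpose (X := fun ω => s ω - t ω)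
    (Y := fun ω => t ω - t' ω), h1, Matrix.transpose_zero, add_zero, errorCov]

end LinearEstimators

/-- The determinant of the filtered error covariance. -/
theorem det_riccati_update {n m : ℕ} (M : Matrix (Fin n) (Fin n) ℝ) (H : Matrix (Fin m) (Fin n) ℝ)
    {W R : Matrix (Fin m) (Fin m) ℝ} (hR : R = H * M * Hᵀ + W) (hdet : IsUnit R.det) :
    (M - M * Hᵀ * R⁻¹ * (H * M)).det = M.det * (W.det / R.det) := by
  -- Factor out `M` and apply `|1 - AB| = |1 - BA|`, where `1 - H M Hᵀ R⁻¹ = W R⁻¹`; `M` may be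
  -- singular.
  have h1 : M - M * Hᵀ * R⁻¹ * (H * M) = M * (1 - (Hᵀ * R⁻¹) * (H * M)) := by
    rw [Matrix.mul_sub, Matrix.mul_one]
    simp only [Matrix.mul_assoc]
  have h2 : 1 - (H * M) * (Hᵀ * R⁻¹) = W * R⁻¹ := by
    rw [← Matrix.mul_nonsing_inv R hdet]
    nth_rewrite 1 [hR]
    rw [Matrix.add_mul, add_sub_right_comm]
    simp only [Matrix.mul_assoc, sub_self, zero_add]
  rw [h1, Matrix.det_mul, Matrix.det_one_sub_mul_comm, h2, Matrix.det_mul,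
    Matrix.det_nonsing_inv, Ring.inverse_eq_inv', div_eq_mul_inv]

/-! ### Orthogonality relations in the Kalman model -/

namespace IsKalmanModel

variable {Ω : Type*} [MeasurableSpace Ω] {μ : Measure Ω}
  {n m : ℕ} {x u : ℕ → Ω → Fin n → ℝ} {w z : ℕ → Ω → Fin m → ℝ}
  {F : ℕ → Matrix (Fin n) (Fin n) ℝ} {H : ℕ → Matrix (Fin m) (Fin n) ℝ}
  {U : ℕ → Matrix (Fin n) (Fin n) ℝ} {W : ℕ → Matrix (Fin m) (Fin m) ℝ}

theorem memLp_signal (h : IsKalmanModel μ x u w z F H U W) (k : ℕ) : MemLp (x k) 2 μ := by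
  induction k with
  | zero => exact h.memLp_init
  | succ k ih =>
    rw [show x (k + 1) = fun ω => F k *ᵥ x k ω + u k ω from funext (h.state_eq k)]
    exact (memLp_two_mulVec ih (F k)).add (h.memLp_input k)

theorem memLp_noise (h : IsKalmanModel μ x u w z F H U W) (k : ℕ) : MemLp (w k) 2 μ :=
  (h.gaussian_noise.hasGaussianLaw_eval k).memLp_two

/-- Displays the innovation as the estimation error seen through `H` plus fresh noise; for
predictions the two are uncorrelated. -/
theorem innovation_eq (h : IsKalmanModel μ x u w z F H U W) (k : ℕ) (t : Ω → Fin n → ℝ) :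
    (fun ω => z k ω - H k *ᵥ t ω) = fun ω => H k *ᵥ (x k ω - t ω) + w k ω := by
  ext1 ω
  rw [h.obs_eq, Matrix.mulVec_sub]
  abel

theorem errorCov_transpose (s t : Ω → Fin n → ℝ) : (errorCov μ s t)ᵀ = errorCov μ s t :=
  expOuter_transpose _ _

theorem memLp_obs (h : IsKalmanModel μ x u w z F H U W) (k : ℕ) : MemLp (z k) 2 μ := by
  rw [show z k = fun ω => H k *ᵥ x k ω + w k ω from funext (h.obs_eq k)]
  exact (memLp_two_mulVec (h.memLp_signal k) (H k)).add (h.memLp_noise k)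

theorem expOuter_signal_noise (h : IsKalmanModel μ x u w z F H U W) (k l : ℕ) :
    expOuter μ (x k) (w l) = 0 :=
  expOuter_eq_zero_of_indepFun (h.memLp_signal k).aemeasurable (h.memLp_noise l).aemeasurable
    (h.indep_signal_noise.comp (measurable_pi_apply k) (measurable_pi_apply l)) (h.mean_noise l)

theorem expOuter_signal_input (h : IsKalmanModel μ x u w z F H U W) {k l : ℕ} (hl : l ≤ k) :
    expOuter μ (x l) (u k) = 0 :=
  expOuter_eq_zero_of_indepFun (h.memLp_signal l).aemeasurable (h.memLp_input k).aemeasurable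
    (h.indep_input_signal k l hl).symm (h.mean_input k)

/-- The input is a linear function of two consecutive states, and the signal is independent of the
noise. -/
theorem expOuter_input_noise (h : IsKalmanModel μ x u w z F H U W) (k l : ℕ) :
    expOuter μ (u k) (w l) = 0 := by
  have hu : u k = fun ω => x (k + 1) ω - F k *ᵥ x k ω := by
    ext1 ω; rw [h.state_eq]; abel
  rw [hu, expOuter_sub_left (h.memLp_signal _) (memLp_two_mulVec (h.memLp_signal k) _)
    (h.memLp_noise l), expOuter_mulVec_left (h.memLp_signal k) (h.memLp_noise l),
    h.expOuter_signal_noise, h.expOuter_signal_noise, Matrix.mul_zero, sub_zero]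

variable [IsProbabilityMeasure μ]

theorem expOuter_noise_linearEstimator (h : IsKalmanModel μ x u w z F H U W) {p : ℕ} (k : ℕ)
    (a : Fin p → ℝ) (A : ℕ → Matrix (Fin p) (Fin m) ℝ) :
    expOuter μ (w k) (linearEstimator z k a A) = 0 := by
  refine expOuter_linearEstimator_eq_zero (h.memLp_noise k) h.memLp_obs (h.mean_noise k)
    (fun l hl => ?_) a A
  rw [show z l = fun ω => H l *ᵥ x l ω + w l ω from funext (h.obs_eq l),
    expOuter_add_right (h.memLp_noise k) (memLp_two_mulVec (h.memLp_signal l) _) (h.memLp_noise l),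
    expOuter_mulVec_right (h.memLp_noise k) (h.memLp_signal l), h.cov_noise, if_neg hl.ne',
    ← expOuter_transpose, h.expOuter_signal_noise]
  simp

/-- The input `u k` first enters at `x (k + 1)`, so it is uncorrelated with `z k` as well: `k + 1`
observations here, against `k` for the noise `w k`. -/
theorem expOuter_input_linearEstimator (h : IsKalmanModel μ x u w z F H U W) {p : ℕ} (k : ℕ)
    (a : Fin p → ℝ) (A : ℕ → Matrix (Fin p) (Fin m) ℝ) :
    expOuter μ (u k) (linearEstimator z (k + 1) a A) = 0 := by
  refine expOuter_linearEstimator_eq_zero (h.memLp_input k) h.memLp_obs (h.mean_input k)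
    (fun l hl => ?_) a A
  rw [show z l = fun ω => H l *ᵥ x l ω + w l ω from funext (h.obs_eq l),
    expOuter_add_right (h.memLp_input k) (memLp_two_mulVec (h.memLp_signal l) _) (h.memLp_noise l),
    expOuter_mulVec_right (h.memLp_input k) (h.memLp_signal l), h.expOuter_input_noise,
    ← expOuter_transpose, h.expOuter_signal_input (Nat.lt_succ_iff.1 hl)]
  simp

theorem memLp_estimate (h : IsKalmanModel μ x u w z F H U W) {r : ℕ} {s t : Ω → Fin n → ℝ}
    (ht : IsLinearLeastSquares μ z r s t) : MemLp t 2 μ := by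
  obtain ⟨a, A, rfl⟩ := ht.1
  exact memLp_linearEstimator h.memLp_obs r a A

theorem memLp_error (h : IsKalmanModel μ x u w z F H U W) {r k : ℕ} {t : Ω → Fin n → ℝ}
    (ht : IsLinearLeastSquares μ z r (x k) t) : MemLp (fun ω => x k ω - t ω) 2 μ :=
  (h.memLp_signal k).sub (h.memLp_estimate ht)

theorem memLp_innovation (h : IsKalmanModel μ x u w z F H U W) {k : ℕ} {t : Ω → Fin n → ℝ}
    (ht : IsLinearLeastSquares μ z k (x k) t) : MemLp (fun ω => z k ω - H k *ᵥ t ω) 2 μ :=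
  (h.memLp_obs k).sub (memLp_two_mulVec (h.memLp_estimate ht) (H k))

theorem expOuter_error_noise (h : IsKalmanModel μ x u w z F H U W) {k : ℕ} {t : Ω → Fin n → ℝ}
    (ht : IsLinearLeastSquares μ z k (x k) t) :
    expOuter μ (fun ω => x k ω - t ω) (w k) = 0 := by
  have h2 := h.memLp_estimate ht
  obtain ⟨a, A, rfl⟩ := ht.1
  rw [expOuter_sub_left (h.memLp_signal k) h2 (h.memLp_noise k), h.expOuter_signal_noise,
    ← expOuter_transpose (X := w k), h.expOuter_noise_linearEstimator]
  simp

theorem expOuter_error_innovation (h : IsKalmanModel μ x u w z F H U W) {k : ℕ}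
    {t : Ω → Fin n → ℝ} (ht : IsLinearLeastSquares μ z k (x k) t) :
    expOuter μ (fun ω => x k ω - t ω) (fun ω => z k ω - H k *ᵥ t ω) =
      errorCov μ (x k) t * (H k)ᵀ := by
  have he := h.memLp_error ht
  rw [h.innovation_eq, expOuter_add_right he (memLp_two_mulVec he _) (h.memLp_noise k),
    h.expOuter_error_noise ht, add_zero, expOuter_mulVec_right he he, errorCov]

theorem expOuter_innovation_error (h : IsKalmanModel μ x u w z F H U W) {k : ℕ}
    {t : Ω → Fin n → ℝ} (ht : IsLinearLeastSquares μ z k (x k) t) :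
    expOuter μ (fun ω => z k ω - H k *ᵥ t ω) (fun ω => x k ω - t ω) =
      H k * errorCov μ (x k) t := by
  rw [← expOuter_transpose, h.expOuter_error_innovation ht, Matrix.transpose_mul,
    Matrix.transpose_transpose, errorCov_transpose]

theorem expOuter_innovation_linearEstimator (h : IsKalmanModel μ x u w z F H U W) {k p : ℕ}
    {t : Ω → Fin n → ℝ} (ht : IsLinearLeastSquares μ z k (x k) t) (a : Fin p → ℝ)
    (A : ℕ → Matrix (Fin p) (Fin m) ℝ) :
    expOuter μ (fun ω => z k ω - H k *ᵥ t ω) (linearEstimator z k a A) = 0 := by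
  have he := h.memLp_error ht
  have hl := memLp_linearEstimator h.memLp_obs k a A
  rw [h.innovation_eq, expOuter_add_left (memLp_two_mulVec he _) (h.memLp_noise k) hl,
    expOuter_mulVec_left he hl, ht.expOuter_eq_zero (h.memLp_signal k) h.memLp_obs,
    h.expOuter_noise_linearEstimator, Matrix.mul_zero, add_zero]

theorem integral_innovation (h : IsKalmanModel μ x u w z F H U W) {k : ℕ} {t : Ω → Fin n → ℝ}
    (ht : IsLinearLeastSquares μ z k (x k) t) (i : Fin m) :
    ∫ ω, (z k ω - H k *ᵥ t ω) i ∂μ = 0 := by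
  -- The constant `1` is a linear estimator, so orthogonality to it is the vanishing of the mean.
  have h1 := h.expOuter_innovation_linearEstimator ht (fun _ : Fin 1 => 1) fun _ => 0
  rw [linearEstimator_zero_coeff] at h1
  simpa [expOuter] using congrFun (congrFun h1 i) 0

theorem innovationCov_eq (h : IsKalmanModel μ x u w z F H U W) {k : ℕ} {t : Ω → Fin n → ℝ}
    (ht : IsLinearLeastSquares μ z k (x k) t) :
    innovationCov μ (z k) (H k) t = H k * errorCov μ (x k) t * (H k)ᵀ + W k := by
  have he := h.memLp_error ht
  have hν : MemLp (fun ω => H k *ᵥ (x k ω - t ω) + w k ω) 2 μ := by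
    rw [← h.innovation_eq]; exact h.memLp_innovation ht
  have h1 := h.expOuter_error_innovation ht
  rw [h.innovation_eq] at h1
  rw [innovationCov, h.innovation_eq,
    expOuter_add_left (memLp_two_mulVec he _) (h.memLp_noise k) hν,
    expOuter_mulVec_left he hν, h1,
    expOuter_add_right (h.memLp_noise k) (memLp_two_mulVec he _) (h.memLp_noise k),
    expOuter_mulVec_right (h.memLp_noise k) he, ← expOuter_transpose (Y := w k),
    h.expOuter_error_noise ht, h.cov_noise, if_pos rfl, Matrix.mul_assoc]
  simp

theorem errorCov_posSemidef (h : IsKalmanModel μ x u w z F H U W) {r k : ℕ} {t : Ω → Fin n → ℝ}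
    (ht : IsLinearLeastSquares μ z r (x k) t) : (errorCov μ (x k) t).PosSemidef :=
  expOuter_self_posSemidef (h.memLp_error ht)

/-- The noise term `W k` is positive definite, however degenerate the prediction error. -/
theorem innovationCov_posDef (h : IsKalmanModel μ x u w z F H U W) {k : ℕ} {t : Ω → Fin n → ℝ}
    (ht : IsLinearLeastSquares μ z k (x k) t) : (innovationCov μ (z k) (H k) t).PosDef := by
  rw [h.innovationCov_eq ht]
  have := (h.errorCov_posSemidef ht).mul_mul_conjTranspose_same (H k)
  rw [Matrix.conjTranspose_eq_transpose_of_trivial] at this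
  exact Matrix.PosDef.posSemidef_add this (h.posDef_noise k)

/-! ### Measurement and time updates -/

/-- The measurement update of the error covariance. -/
theorem errorCov_filter_eq (h : IsKalmanModel μ x u w z F H U W) {k : ℕ} {t t' : Ω → Fin n → ℝ}
    (ht : IsLinearLeastSquares μ z k (x k) t) (ht' : IsLinearLeastSquares μ z (k + 1) (x k) t') :
    errorCov μ (x k) t' = errorCov μ (x k) t -
      errorCov μ (x k) t * (H k)ᵀ * (innovationCov μ (z k) (H k) t)⁻¹ *
        (H k * errorCov μ (x k) t) := by
  set M := errorCov μ (x k) t with hM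
  set R := innovationCov μ (z k) (H k) t with hR
  -- The Kalman gain, chosen so that `K R = M Hᵀ = E[e νᵀ]`: it makes `e - K ν` orthogonal to `ν`.
  set K : Matrix (Fin n) (Fin m) ℝ := M * (H k)ᵀ * R⁻¹ with hK
  have hRunit : IsUnit R.det := isUnit_iff_ne_zero.2 (h.innovationCov_posDef ht).det_pos.ne'
  have hKR : K * R = M * (H k)ᵀ := by
    rw [hK, Matrix.mul_assoc, Matrix.nonsing_inv_mul _ hRunit, Matrix.mul_one]
  have he := h.memLp_error ht
  have hν := h.memLp_innovation ht
  set e : Ω → Fin n → ℝ := fun ω => x k ω - t ω with he_def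
  set ν : Ω → Fin m → ℝ := fun ω => z k ω - H k *ᵥ t ω with hν_def
  set s : Ω → Fin n → ℝ := fun ω => t ω + K *ᵥ ν ω with hs
  have herr : (fun ω => x k ω - s ω) = fun ω => e ω - K *ᵥ ν ω := by
    ext1 ω; simp only [hs, he_def]; abel
  have hKν := memLp_two_mulVec hν K
  have herr2 : MemLp (fun ω => e ω - K *ᵥ ν ω) 2 μ := he.sub hKν
  have horthν : expOuter μ (fun ω => e ω - K *ᵥ ν ω) ν = 0 := by
    rw [expOuter_sub_left he hKν hν, expOuter_mulVec_left hν hν,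
      h.expOuter_error_innovation ht, ← hM, ← hKR, sub_eq_zero]
    rfl
  have horth : ∀ {p : ℕ} (a : Fin p → ℝ) A,
      expOuter μ (fun ω => e ω - K *ᵥ ν ω) (linearEstimator z k a A) = 0 := by
    intro p a A
    have hl := memLp_linearEstimator h.memLp_obs k a A
    rw [expOuter_sub_left he hKν hl, expOuter_mulVec_left hν hl,
      ht.expOuter_eq_zero (h.memLp_signal k) h.memLp_obs,
      h.expOuter_innovation_linearEstimator ht, Matrix.mul_zero, sub_zero]
  obtain ⟨a₀, A₀, ht₀⟩ := ht.1
  -- The new observation is the innovation plus a linear function of the past, so orthogonality to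
  -- these two gives orthogonality to `z k`.
  have hzdec : z k = fun ω => ν ω + linearEstimator z k (H k *ᵥ a₀) (fun l => H k * A₀ l) ω := by
    rw [← linearEstimator_mulVec, ← ht₀]
    ext1 ω
    simp only [hν_def, sub_add_cancel]
  have horthz : expOuter μ (fun ω => e ω - K *ᵥ ν ω) (z k) = 0 := by
    have hl := memLp_linearEstimator h.memLp_obs k (H k *ᵥ a₀) (fun l => H k * A₀ l)
    rw [hzdec, expOuter_add_right herr2 hν hl, horthν, horth, add_zero]
  have hslin : ∃ a A, s = linearEstimator z (k + 1) a A := by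
    have : s = fun ω => linearEstimator z k a₀ A₀ ω -
        linearEstimator z k (K *ᵥ (H k *ᵥ a₀)) (fun l => K * (H k * A₀ l)) ω + K *ᵥ z k ω := by
      rw [← linearEstimator_mulVec, ← linearEstimator_mulVec, ← ht₀]
      ext1 ω
      simp only [hs, hν_def, Matrix.mulVec_sub]
      abel
    rw [this]
    have h1 := linearEstimator_sub (z := z) k a₀ (K *ᵥ (H k *ᵥ a₀)) A₀
      (fun l => K * (H k * A₀ l))
    have h2 := linearEstimator_add_obs (z := z) k (a₀ - K *ᵥ (H k *ᵥ a₀))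
      (A₀ - fun l => K * (H k * A₀ l)) K
    rw [← h1] at h2
    exact ⟨_, _, h2⟩
  -- As `e - K ν` is orthogonal to `ν`, its covariance is `E[(e - K ν) eᵀ] = M - K H M`.
  rw [ht'.errorCov_eq (h.memLp_signal k) h.memLp_obs hslin fun a A => ?_, errorCov, herr,
    expOuter_sub_right herr2 he hKν, expOuter_mulVec_right herr2 hν, horthν, Matrix.zero_mul,
    sub_zero, expOuter_sub_left he hKν he, expOuter_mulVec_left hν he,
    h.expOuter_innovation_error ht]
  · rfl
  · have hl := memLp_linearEstimator h.memLp_obs k a A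
    rw [herr, linearEstimator_succ, expOuter_add_right herr2 hl
      (memLp_two_mulVec (h.memLp_obs k) _), horth, expOuter_mulVec_right herr2 (h.memLp_obs k),
      horthz, Matrix.zero_mul, add_zero]

theorem det_errorCov_filter (h : IsKalmanModel μ x u w z F H U W) {k : ℕ} {t t' : Ω → Fin n → ℝ}
    (ht : IsLinearLeastSquares μ z k (x k) t) (ht' : IsLinearLeastSquares μ z (k + 1) (x k) t') :
    (errorCov μ (x k) t').det = (errorCov μ (x k) t).det *
      ((W k).det / (innovationCov μ (z k) (H k) t).det) := by
  rw [h.errorCov_filter_eq ht ht']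
  exact det_riccati_update _ _ (h.innovationCov_eq ht)
    (isUnit_iff_ne_zero.2 (h.innovationCov_posDef ht).det_pos.ne')

/-- An error covariance is positive semidefinite, so a nonzero determinant suffices, and the
determinant formula supplies it. -/
theorem errorCov_filter_posDef (h : IsKalmanModel μ x u w z F H U W) {k : ℕ}
    {t t' : Ω → Fin n → ℝ} (ht : IsLinearLeastSquares μ z k (x k) t)
    (ht' : IsLinearLeastSquares μ z (k + 1) (x k) t') (hM : (errorCov μ (x k) t).PosDef) :
    (errorCov μ (x k) t').PosDef := by
  rw [(h.errorCov_posSemidef ht').posDef_iff_det_ne_zero, h.det_errorCov_filter ht ht']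
  exact mul_ne_zero hM.det_pos.ne'
    (div_ne_zero (h.posDef_noise k).det_pos.ne' (h.innovationCov_posDef ht).det_pos.ne')

/-- The time update of the error covariance. -/
theorem errorCov_predict_eq (h : IsKalmanModel μ x u w z F H U W) {k : ℕ} {t t' : Ω → Fin n → ℝ}
    (ht : IsLinearLeastSquares μ z (k + 1) (x k) t)
    (ht' : IsLinearLeastSquares μ z (k + 1) (x (k + 1)) t') :
    errorCov μ (x (k + 1)) t' = F k * errorCov μ (x k) t * (F k)ᵀ + U k := by
  have he := h.memLp_error ht
  have hu := h.memLp_input k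
  have hFe := memLp_two_mulVec he (F k)
  have hFu : MemLp (fun ω => F k *ᵥ (x k ω - t ω) + u k ω) 2 μ := hFe.add hu
  have ht2 := h.memLp_estimate ht
  obtain ⟨a₀, A₀, ht₀⟩ := ht.1
  -- The candidate prediction is `F k` applied to the filtered estimate. Its error adds the input `u
  -- k`, which is uncorrelated with the filtering error and with the observations used.
  have herr : (fun ω => x (k + 1) ω - F k *ᵥ t ω) =
      fun ω => F k *ᵥ (x k ω - t ω) + u k ω := by
    ext1 ω; rw [h.state_eq, Matrix.mulVec_sub]; abel
  have heu : expOuter μ (fun ω => x k ω - t ω) (u k) = 0 := by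
    rw [expOuter_sub_left (h.memLp_signal k) ht2 hu, h.expOuter_signal_input le_rfl,
      ← expOuter_transpose (X := u k), ht₀, h.expOuter_input_linearEstimator]
    simp
  rw [ht'.errorCov_eq (h.memLp_signal _) h.memLp_obs (t' := fun ω => F k *ᵥ t ω)
    ⟨F k *ᵥ a₀, fun l => F k * A₀ l, by rw [← linearEstimator_mulVec, ← ht₀]⟩ fun a A => ?_,
    errorCov, herr, expOuter_add_left hFe hu hFu, expOuter_add_right hu hFe hu,
    h.cov_input, if_pos rfl, expOuter_mulVec_left he hFu, expOuter_mulVec_right hu he,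
    expOuter_add_right he hFe hu, heu, ← expOuter_transpose (Y := u k), heu,
    expOuter_mulVec_right he he, errorCov, Matrix.mul_assoc]
  · simp
  · have hl := memLp_linearEstimator h.memLp_obs (k + 1) a A
    rw [herr, expOuter_add_left hFe hu hl, expOuter_mulVec_left he hl,
      ht.expOuter_eq_zero (h.memLp_signal k) h.memLp_obs, h.expOuter_input_linearEstimator]
    simp

theorem errorCov_predict_posDef (h : IsKalmanModel μ x u w z F H U W) {k : ℕ}
    {t t' : Ω → Fin n → ℝ} (ht : IsLinearLeastSquares μ z (k + 1) (x k) t)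
    (ht' : IsLinearLeastSquares μ z (k + 1) (x (k + 1)) t') (hF : IsUnit (F k))
    (hP : (errorCov μ (x k) t).PosDef) : (errorCov μ (x (k + 1)) t').PosDef := by
  rw [h.errorCov_predict_eq ht ht']
  have hU : (U k).PosSemidef := by
    have := expOuter_self_posSemidef (h.memLp_input k)
    rwa [h.cov_input, if_pos rfl] at this
  have h1 := hP.mul_mul_conjTranspose_same (B := F k) (Matrix.vecMul_injective_of_isUnit hF)
  rw [Matrix.conjTranspose_eq_transpose_of_trivial] at h1
  exact h1.add_posSemidef hU

/-- With no observations the linear estimators are the constants, and the mean has the orthogonal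
error. -/
theorem errorCov_init (h : IsKalmanModel μ x u w z F H U W) {t : Ω → Fin n → ℝ}
    (ht : IsLinearLeastSquares μ z 0 (x 0) t) : errorCov μ (x 0) t = covMat μ (x 0) := by
  refine ht.errorCov_eq (h.memLp_signal 0) h.memLp_obs (t' := fun _ i => ∫ ω, x 0 ω i ∂μ)
    ⟨_, fun _ => 0, (linearEstimator_zero_coeff 0 _).symm⟩ fun a A => ?_
  have h0 : linearEstimator z 0 a A = fun _ => a := by ext ω i; simp [linearEstimator]
  rw [h0]
  refine expOuter_const_right (fun i => ?_) a
  simp only [Pi.sub_apply]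
  rw [integral_sub (((h.memLp_signal 0).eval i).integrable (by norm_num)) (integrable_const _)]
  simp

theorem errorCov_posDef (h : IsKalmanModel μ x u w z F H U W)
    {xpred xfilt : ℕ → Ω → Fin n → ℝ} (hpred : ∀ j, IsLinearLeastSquares μ z j (x j) (xpred j))
    (hfilt : ∀ j, IsLinearLeastSquares μ z (j + 1) (x j) (xfilt j))
    (hinit : (covMat μ (x 0)).PosDef) {k : ℕ} (hF : ∀ j < k, IsUnit (F j)) {j : ℕ} (hj : j ≤ k) :
    (errorCov μ (x j) (xpred j)).PosDef := by
  induction j with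
  | zero => rwa [h.errorCov_init (hpred 0)]
  | succ j ih =>
    exact h.errorCov_predict_posDef (hfilt j) (hpred (j + 1)) (hF j hj)
      (h.errorCov_filter_posDef (hpred j) (hfilt j) (ih (Nat.le_of_succ_le hj)))

end IsKalmanModel

/-! ### Stacked processes and block matrices -/

/-- The first `k + 1` vectors of a process, as a single vector. -/
def stack {Ω : Type*} {a : ℕ} (y : ℕ → Ω → Fin a → ℝ) (k : ℕ) : Ω → Fin a × Fin (k + 1) → ℝ :=
  fun ω p => y p.2 ω p.1

/-- The quadratic form is the sum of those of the blocks, and a nonzero vector has a nonzero block.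
-/
theorem posDef_blockDiagonal {ι κ : Type*} [Fintype ι] [DecidableEq ι] [Fintype κ] [DecidableEq κ]
    {C : κ → Matrix ι ι ℝ} (hC : ∀ j, (C j).PosDef) : (Matrix.blockDiagonal C).PosDef := by
  refine Matrix.PosDef.of_dotProduct_mulVec_pos ?_ fun v hv => ?_
  · rw [Matrix.IsHermitian, Matrix.blockDiagonal_conjTranspose]
    congr 1
    ext1 j
    exact (hC j).isHermitian
  · have hsum : star v ⬝ᵥ (Matrix.blockDiagonal C *ᵥ v) =
        ∑ j, star (fun i => v (i, j)) ⬝ᵥ (C j *ᵥ fun i => v (i, j)) := by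
      simp only [dotProduct, Matrix.mulVec, Matrix.blockDiagonal_apply, Fintype.sum_prod_type,
        ite_mul, zero_mul, Finset.sum_ite_eq, Finset.mem_univ, if_true, Pi.star_apply]
      exact Finset.sum_comm
    rw [hsum]
    obtain ⟨⟨i, j⟩, hij⟩ := Function.ne_iff.1 hv
    refine Finset.sum_pos' (fun j _ => (hC j).posSemidef.dotProduct_mulVec_nonneg _)
      ⟨j, Finset.mem_univ j, (hC j).dotProduct_mulVec_pos fun h => hij (congrFun h i)⟩

theorem covarianceMatrix_stack {Ω : Type*} [MeasurableSpace Ω] {μ : Measure Ω} {a : ℕ}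
    {y : ℕ → Ω → Fin a → ℝ} (hy : ∀ j i, ∫ ω, y j ω i ∂μ = 0)
    {C : ℕ → Matrix (Fin a) (Fin a) ℝ}
    (hC : ∀ j l, expOuter μ (y j) (y l) = if j = l then C j else 0) (k : ℕ) :
    covarianceMatrix μ (stack y k) = Matrix.blockDiagonal fun j : Fin (k + 1) => C j := by
  ext ⟨i, j⟩ ⟨i', l⟩
  have h := congrFun (congrFun (hC j l) i) i'
  simp only [covarianceMatrix, stack, Matrix.of_apply, Matrix.blockDiagonal_apply, covariance, hy,
    sub_zero]
  simp only [expOuter, Matrix.of_apply] at h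
  rw [h]
  by_cases hjl : j = l
  · simp [hjl]
  · have : (j : ℕ) ≠ l := fun h => hjl (Fin.ext h)
    simp [hjl, this]

/-- The strictly lower block triangular matrix with blocks `B j l`, `l < j`. -/
def strictLowerBlocks {a k : ℕ} (B : ℕ → ℕ → Matrix (Fin a) (Fin a) ℝ) :
    Matrix (Fin a × Fin (k + 1)) (Fin a × Fin (k + 1)) ℝ :=
  Matrix.of fun p q => if q.2 < p.2 then B p.2 q.2 p.1 q.1 else 0

theorem det_one_sub_strictLowerBlocks {a k : ℕ} (B : ℕ → ℕ → Matrix (Fin a) (Fin a) ℝ) :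
    (1 - strictLowerBlocks B : Matrix (Fin a × Fin (k + 1)) (Fin a × Fin (k + 1)) ℝ).det = 1 := by
  -- `BlockTriangular` is the upper triangular condition, hence the transpose; the blocks are
  -- indexed by time and the diagonal ones are identities.
  have htri : ((1 - strictLowerBlocks B :
      Matrix (Fin a × Fin (k + 1)) (Fin a × Fin (k + 1)) ℝ)ᵀ).BlockTriangular Prod.snd := by
    intro p q hpq
    have hne : q ≠ p := fun h => by simp [h] at hpq
    simp [strictLowerBlocks, hne, hpq.not_gt]
  rw [← Matrix.det_transpose, htri.det]
  refine Finset.prod_eq_one fun j _ => ?_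
  have : ((1 - strictLowerBlocks B :
      Matrix (Fin a × Fin (k + 1)) (Fin a × Fin (k + 1)) ℝ)ᵀ).toSquareBlock Prod.snd j = 1 := by
    ext ⟨p, hp⟩ ⟨q, hq⟩
    have hpq : ¬ p.2 < q.2 := by simp_all
    simp [Matrix.toSquareBlock_def, strictLowerBlocks, Matrix.one_apply, hpq]
  rw [this, Matrix.det_one]

theorem strictLowerBlocks_mulVec_stack {Ω : Type*} {a k : ℕ}
    (B : ℕ → ℕ → Matrix (Fin a) (Fin a) ℝ) (y : ℕ → Ω → Fin a → ℝ) (ω : Ω)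
    (p : Fin a × Fin (k + 1)) :
    (strictLowerBlocks B *ᵥ stack y k ω) p = ∑ l ∈ Finset.range p.2, (B p.2 l *ᵥ y l ω) p.1 := by
  obtain ⟨i, j⟩ := p
  simp only [strictLowerBlocks, stack, Matrix.mulVec, dotProduct, Matrix.of_apply,
    Fintype.sum_prod_type, ite_mul, zero_mul]
  rw [Finset.sum_comm]
  have h1 : ∀ l : Fin (k + 1), (∑ i', if l < j then B j l i i' * y l ω i' else 0) =
      if (l : ℕ) < j then ∑ i', B j l i i' * y l ω i' else 0 := fun l => by
    by_cases hl : l < j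
    · simp [hl]
    · have : ¬ (l : ℕ) < j := hl
      simp [hl]
  simp only [h1]
  rw [Fin.sum_univ_eq_sum_range
    (fun l => if l < (j : ℕ) then ∑ i', B j l i i' * y l ω i' else 0) (k + 1),
    ← Finset.sum_filter]
  refine Finset.sum_congr ?_ fun _ _ => rfl
  ext l
  simp only [Finset.mem_filter, Finset.mem_range]
  have := j.2
  omega

/-! ### Innovations and the bound for the whole block -/

namespace IsKalmanModel

variable {Ω : Type*} [MeasurableSpace Ω] {μ : Measure Ω}
  {n m : ℕ} {x u : ℕ → Ω → Fin n → ℝ} {w z : ℕ → Ω → Fin m → ℝ}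
  {F : ℕ → Matrix (Fin n) (Fin n) ℝ} {H : ℕ → Matrix (Fin m) (Fin n) ℝ}
  {U : ℕ → Matrix (Fin n) (Fin n) ℝ} {W : ℕ → Matrix (Fin m) (Fin m) ℝ}
  {xpred : ℕ → Ω → Fin n → ℝ}

theorem memLp_stack_obs (h : IsKalmanModel μ x u w z F H U W) (k : ℕ) (p : Fin m × Fin (k + 1)) :
    MemLp (fun ω => stack z k ω p) 2 μ :=
  (h.memLp_obs p.2).eval p.1

theorem hasGaussianLaw_stack_noise (h : IsKalmanModel μ x u w z F H U W) (k : ℕ) :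
    HasGaussianLaw (stack w k) μ := by
  have hk : ∀ p : Fin m × Fin (k + 1), (p.2 : ℕ) ∈ Finset.range (k + 1) := fun p =>
    Finset.mem_range.2 p.2.2
  exact (h.gaussian_noise.hasGaussianLaw (Finset.range (k + 1))).map_fun
    (ContinuousLinearMap.pi fun p : Fin m × Fin (k + 1) =>
      (ContinuousLinearMap.proj (R := ℝ) (φ := fun _ : Fin m => ℝ) p.1).comp
        (ContinuousLinearMap.proj (R := ℝ)
          (φ := fun _ : Finset.range (k + 1) => Fin m → ℝ) ⟨p.2, hk p⟩))

variable [IsProbabilityMeasure μ]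

/-- The innovations are uncorrelated. -/
theorem expOuter_innovation_innovation (h : IsKalmanModel μ x u w z F H U W)
    (hpred : ∀ j, IsLinearLeastSquares μ z j (x j) (xpred j)) (j l : ℕ) :
    expOuter μ (fun ω => z j ω - H j *ᵥ xpred j ω) (fun ω => z l ω - H l *ᵥ xpred l ω) =
      if j = l then innovationCov μ (z j) (H j) (xpred j) else 0 := by
  have key : ∀ {j l : ℕ}, l < j → expOuter μ (fun ω => z j ω - H j *ᵥ xpred j ω)
      (fun ω => z l ω - H l *ᵥ xpred l ω) = 0 := by
    intro j l hl
    obtain ⟨a, A, ha⟩ := (hpred l).1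
    -- An earlier innovation is a linear estimator from the first `j` observations: it uses `z l`
    -- with coefficient `1` and nothing between `l` and `j`, so padding with zeros suffices.
    have h1 : (fun ω => z l ω - H l *ᵥ xpred l ω) = linearEstimator z j (-(H l *ᵥ a))
        fun i => if i < l then -(H l * A i) else if i = l then 1 else 0 := by
      ext1 ω
      rw [ha]
      have hsum : ∑ i ∈ Finset.range j,
          (if i < l then -(H l * A i) else if i = l then 1 else 0) *ᵥ z i ω =
          ∑ i ∈ Finset.range (l + 1),
          (if i < l then -(H l * A i) else if i = l then 1 else 0) *ᵥ z i ω := by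
        refine (Finset.sum_subset (Finset.range_subset_range.2 hl) fun i _ hi => ?_).symm
        rw [Finset.mem_range, not_lt] at hi
        rw [if_neg (by omega), if_neg (by omega), Matrix.zero_mulVec]
      have hlow : ∑ i ∈ Finset.range l,
          (if i < l then -(H l * A i) else if i = l then 1 else 0) *ᵥ z i ω =
          -∑ i ∈ Finset.range l, (H l * A i) *ᵥ z i ω := by
        rw [← Finset.sum_neg_distrib]
        refine Finset.sum_congr rfl fun i hi => ?_
        rw [if_pos (Finset.mem_range.1 hi), Matrix.neg_mulVec]
      simp only [linearEstimator]
      rw [hsum, Finset.sum_range_succ, hlow, if_neg (lt_irrefl l), if_pos rfl, Matrix.one_mulVec,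
        Matrix.mulVec_add, Matrix.mulVec_sum]
      simp only [Matrix.mulVec_mulVec]
      abel
    rw [h1]
    exact h.expOuter_innovation_linearEstimator (hpred j) _ _
  rcases lt_trichotomy l j with hl | rfl | hl
  · rw [key hl, if_neg hl.ne']
  · rw [if_pos rfl, innovationCov]
  · rw [← expOuter_transpose, key hl, if_neg hl.ne, Matrix.transpose_zero]

/-- The innovations come from the observations by a unit lower triangular transformation, so the
covariance matrix of the observations has the determinant of that of the innovations. -/
theorem det_covarianceMatrix_obs (h : IsKalmanModel μ x u w z F H U W)
    (hpred : ∀ j, IsLinearLeastSquares μ z j (x j) (xpred j)) (k : ℕ) :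
    (covarianceMatrix μ (stack z k)).det =
      ∏ j ∈ Finset.range (k + 1), (innovationCov μ (z j) (H j) (xpred j)).det := by
  choose a A ha using fun j => (hpred j).1
  set T : Matrix (Fin m × Fin (k + 1)) (Fin m × Fin (k + 1)) ℝ :=
    1 - strictLowerBlocks fun j l => H j * A j l with hT
  -- Row block `j` of `T` subtracts the prediction of `z j` from the past. The constant terms,
  -- present because the signal is not centered, do not affect the covariance.
  have hν : (fun ω => T *ᵥ stack z k ω + fun p => -(H p.2 *ᵥ a p.2) p.1) =
      stack (fun j ω => z j ω - H j *ᵥ xpred j ω) k := by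
    ext ω p
    rw [hT, Matrix.sub_mulVec, Matrix.one_mulVec, Pi.add_apply, Pi.sub_apply,
      strictLowerBlocks_mulVec_stack]
    simp only [stack, ha, linearEstimator, Pi.sub_apply, Matrix.mulVec_add, Matrix.mulVec_sum,
      Matrix.mulVec_mulVec, Pi.add_apply, Finset.sum_apply]
    ring
  have hcov := covarianceMatrix_stack (fun j i => h.integral_innovation (hpred j) i)
    (C := fun j => innovationCov μ (z j) (H j) (xpred j))
    (h.expOuter_innovation_innovation hpred) k
  rw [← hν, covarianceMatrix_add_const (memLp_mulVec (h.memLp_stack_obs k) T),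
    covarianceMatrix_mulVec (h.memLp_stack_obs k)] at hcov
  have hdet := congrArg Matrix.det hcov
  rw [Matrix.det_mul, Matrix.det_mul, Matrix.det_transpose, hT, det_one_sub_strictLowerBlocks,
    one_mul, mul_one, Matrix.det_blockDiagonal] at hdet
  rw [hdet, Finset.prod_range]

/-- The channel bound is applied to all times at once; the sum over `j` arises only from factoring
the two determinants. -/
theorem mutualInfo_block_le (h : IsKalmanModel μ x u w z F H U W)
    (hpred : ∀ j, IsLinearLeastSquares μ z j (x j) (xpred j)) (k : ℕ) :
    mutualInfo μ (block x k) (block z k) ≠ ∞ ∧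
      (mutualInfo μ (block x k) (block z k)).toReal ≤ 1 / 2 * ∑ j ∈ Finset.range (k + 1),
        Real.log ((innovationCov μ (z j) (H j) (xpred j)).det / (W j).det) := by
  have hX : AEMeasurable (block x k) μ :=
    aemeasurable_pi_lambda _ fun j => (h.memLp_signal j).aemeasurable
  have hZ : AEMeasurable (stack z k) μ :=
    aemeasurable_pi_lambda _ fun p => (h.memLp_stack_obs k p).aemeasurable
  set φ : (Fin (k + 1) → Fin n → ℝ) → Fin m × Fin (k + 1) → ℝ :=
    fun X p => (H p.2 *ᵥ X p.2) p.1 with hφdef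
  have hφ : Measurable φ := by
    refine measurable_pi_lambda _ fun p => ?_
    simp only [hφdef, Matrix.mulVec, dotProduct]
    fun_prop
  have hL2 : ∀ p, MemLp (fun ω => φ (block x k ω) p) 2 μ := fun p =>
    (memLp_two_mulVec (h.memLp_signal p.2) (H p.2)).eval p.1
  have hcovw := covarianceMatrix_stack h.mean_noise h.cov_noise k
  have hind : IndepFun (block x k) (stack w k) μ :=
    h.indep_signal_noise.comp
      (φ := fun (X : ℕ → Fin n → ℝ) (j : Fin (k + 1)) => X j)
      (ψ := fun (V : ℕ → Fin m → ℝ) (p : Fin m × Fin (k + 1)) => V p.2 p.1)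
      (by fun_prop) (by fun_prop)
  have hsum : (fun ω => φ (block x k ω) + stack w k ω) = stack z k := by
    ext ω p
    simp only [stack, h.obs_eq]
    rfl
  obtain ⟨hfin, hle⟩ := mutualInfo_add_gaussian_le hX hφ hL2 (h.hasGaussianLaw_stack_noise k)
    (fun p => h.mean_noise p.2 p.1) (hcovw ▸ posDef_blockDiagonal fun j => h.posDef_noise j) hind
  rw [hsum] at hfin hle
  have hle' : mutualInfo μ (block x k) (block z k) ≤ mutualInfo μ (block x k) (stack z k) :=
    mutualInfo_comp_right_le (g := fun v (j : Fin (k + 1)) (i : Fin m) => v (i, j)) hX hZ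
      (by fun_prop)
  refine ⟨ne_top_of_le_ne_top hfin hle', (ENNReal.toReal_mono hfin hle').trans (hle.trans_eq ?_)⟩
  rw [h.det_covarianceMatrix_obs hpred, hcovw, Matrix.det_blockDiagonal,
    ← Finset.prod_range fun j => (W j).det, ← Finset.prod_div_distrib, Real.log_prod]
  exact fun j _ => (div_pos (h.innovationCov_posDef (hpred j)).det_pos
    (h.posDef_noise j).det_pos).ne'

end IsKalmanModel

theorem proposition5 {Ω : Type*} [MeasurableSpace Ω] (μ : Measure Ω) [IsProbabilityMeasure μ]
    {n m : ℕ} (x u : ℕ → Ω → Fin n → ℝ) (w z : ℕ → Ω → Fin m → ℝ)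
    (F : ℕ → Matrix (Fin n) (Fin n) ℝ) (H : ℕ → Matrix (Fin m) (Fin n) ℝ)
    (U : ℕ → Matrix (Fin n) (Fin n) ℝ) (W : ℕ → Matrix (Fin m) (Fin m) ℝ)
    (hmodel : IsKalmanModel μ x u w z F H U W)
    -- the one-step predictions and the filtered estimates of the signal
    (xpred xfilt : ℕ → Ω → Fin n → ℝ)
    (hpred : ∀ j, IsLinearLeastSquares μ z j (x j) (xpred j))
    (hfilt : ∀ j, IsLinearLeastSquares μ z (j + 1) (x j) (xfilt j))
    (M P : ℕ → Matrix (Fin n) (Fin n) ℝ) (R : ℕ → Matrix (Fin m) (Fin m) ℝ)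
    (hM : ∀ j, M j = errorCov μ (x j) (xpred j))
    (hP : ∀ j, P j = errorCov μ (x j) (xfilt j))
    (hR : ∀ j, R j = innovationCov μ (z j) (H j) (xpred j))
    (k : ℕ) :
    (mutualInfo μ (block x k) (block z k) ≠ ∞ ∧
      (mutualInfo μ (block x k) (block z k)).toReal ≤
        (1 / 2) * ∑ j ∈ Finset.range (k + 1),
          Real.log ((W j + H j * M j * (H j)ᵀ).det / (W j).det)) ∧
    (1 / 2) * ∑ j ∈ Finset.range (k + 1),
        Real.log ((W j + H j * M j * (H j)ᵀ).det / (W j).det) =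
      (1 / 2) * ∑ j ∈ Finset.range (k + 1), Real.log ((R j).det / (W j).det) ∧
    -- the last expression needs nonsingular error covariances
    ((∀ j ≤ k, (M j).PosDef) →
      (1 / 2) * ∑ j ∈ Finset.range (k + 1), Real.log ((R j).det / (W j).det) =
        (1 / 2) * ∑ j ∈ Finset.range (k + 1), Real.log ((M j).det / (P j).det)) ∧
    -- they are nonsingular for a nondegenerate initial state and nonsingular transitions
    ((covMat μ (x 0)).PosDef → (∀ j < k, IsUnit (F j)) →
      ∀ j ≤ k, (M j).PosDef ∧ (P j).PosDef) := by

  obtain rfl : M = fun j => errorCov μ (x j) (xpred j) := funext hM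
  obtain rfl : P = fun j => errorCov μ (x j) (xfilt j) := funext hP
  obtain rfl : R = fun j => innovationCov μ (z j) (H j) (xpred j) := funext hR
  have hRW : ∀ j, W j + H j * errorCov μ (x j) (xpred j) * (H j)ᵀ =
      innovationCov μ (z j) (H j) (xpred j) := fun j => by
    rw [hmodel.innovationCov_eq (hpred j), add_comm]
  simp only [hRW]
  refine ⟨hmodel.mutualInfo_block_le hpred k, trivial, fun hpos => ?_, fun hinit hF j hj => ?_⟩
  · congr 1
    refine Finset.sum_congr rfl fun j hj => ?_
    have hMj := (hpos j (Nat.lt_succ_iff.1 (Finset.mem_range.1 hj))).det_pos.ne'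
    -- Here `|M| / (|M| (|W| / |R|)) = |R| / |W|`; cancelling `|M|` is what needs positive
    -- definiteness.
    rw [hmodel.det_errorCov_filter (hpred j) (hfilt j), ← div_div, div_self hMj, one_div_div]
  · have hMj := hmodel.errorCov_posDef hpred hfilt hinit hF hj
    exact ⟨hMj, hmodel.errorCov_filter_posDef (hpred j) (hfilt j) hMj⟩
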